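/- Let $M$ be an oriented smooth $6$-manifold. In terms of a basis $(e_i)$ and its dual basis $(e^i)$ put $\omega_0=e^{14}+e^{25}+e^{36}$ and $\varphi_0=e^{123}-e^{156}+e^{246}-e^{345}$ on a $6$-dimensional space, and $\psi_0=\omega_0\wedge e^7+\varphi_0$ on a $7$-dimensional space. An $SU(3)$-structure on $M$ is a pair $(\omega,\varphi)$ of a smooth $2$-form and a smooth $3$-form such that every tangent space has a positively oriented basis in which $(\omega,\varphi)=(\omega_0,\varphi_0)$. Let $K_\varphi$ be the endomorphism with values in $\Lambda^6$ given by $\alpha(K_\varphi X)=\tfrac12\,\alpha\wedge(X\lrcorner\varphi)\wedge\varphi$ for all covectors $\alpha$, let $\epsilon(\varphi)=\sqrt{-\tfrac16\operatorname{tr}K_\varphi^2}$ be the associated positive volume form, $I=I(\varphi)=K_\varphi/\epsilon(\varphi)$ the induced almost complex structure, $\widehat\varphi=-I.\varphi$, i.e. $\widehat\varphi(X,Y,Z)=\varphi(IX,IY,IZ)$, and $g(X,Y)=\omega(X,IY)$ the induced metric. The structure is nearly Kähler if $d\omega=3\varphi$ and $d\widehat\varphi+2\,\omega\wedge\omega=0$.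 A $G_2$-structure on a $7$-manifold is a smooth $3$-form $\psi$ such that every tangent space has a basis (an adapted frame) in which $\psi=\psi_0$; its metric and orientation are those for which all adapted frames are orthonormal and positive. It is nearly parallel if $d\psi=\lambda\ast\psi$ for some constant $\lambda\in\mathbb R\setminus\{0\}$. Let $(\omega,\varphi)$ be a nearly Kähler structure on $M$ with metric $g$, and for $t\in(0,\pi)$ put $$\omega_t=\sin^2(t)\,\omega,\qquad \varphi_t=\sin^3(t)\bigl(\sin(t)\,\widehat\varphi+\cos(t)\,\varphi\bigr).$$ Then $(\omega_t,\varphi_t)$ is an $SU(3)$-structure on $M$ for every $t\in(0,\pi)$, the $3$-form $\psi=\omega_t\wedge dt+\varphi_t$ is a nearly parallel $G_2$-structure on $M\times(0,\pi)$, and the metric of this $G_2$-structure is $\sin^2(t)\,g+dt^2$. -/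

import Mathlib

open scoped Manifold

noncomputable section

namespace SineCone

/-! ### Exterior algebra of a real vector space -/

section LinearAlgebra

variable {V : Type*} [AddCommGroup V] [Module ℝ V]

/-- The wedge product of real-valued alternating maps, normalised so that
`(α ∧ β)(v) = (1 / (k! m!)) ∑ σ, sign σ * α (v (σ 1), …, v (σ k)) * β (v (σ (k+1)), …, v (σ (k+m)))`;
in particular `e¹ ∧ … ∧ eᵏ` takes the value `1` on `(e₁, …, eₖ)`. -/
def altWedge {k m : ℕ} (α : V [⋀^Fin k]→ₗ[ℝ] ℝ) (β : V [⋀^Fin m]→ₗ[ℝ] ℝ) :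
    V [⋀^Fin (k + m)]→ₗ[ℝ] ℝ :=
  ((k.factorial * m.factorial : ℝ)⁻¹) •
    MultilinearMap.alternatization
      ((LinearMap.mul' ℝ ℝ).compMultilinearMap
        ((α.toMultilinearMap.domCoprod β.toMultilinearMap).domDomCongr finSumFinEquiv))

theorem altWedge_apply {k m : ℕ} (α : V [⋀^Fin k]→ₗ[ℝ] ℝ) (β : V [⋀^Fin m]→ₗ[ℝ] ℝ)
    (v : Fin (k + m) → V) :
    altWedge α β v = ((k.factorial * m.factorial : ℝ)⁻¹) *
      ∑ σ : Equiv.Perm (Fin (k + m)), Equiv.Perm.sign σ •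
        (α (fun i => v (σ (Fin.castAdd m i))) * β (fun j => v (σ (Fin.natAdd k j)))) := by
  simp [altWedge, MultilinearMap.alternatization_apply, MultilinearMap.domDomCongr_apply,
    MultilinearMap.domCoprod_apply]

/-- The wedge product of continuous alternating maps. -/
def wedge [TopologicalSpace V] {k m : ℕ} (α : V [⋀^Fin k]→L[ℝ] ℝ) (β : V [⋀^Fin m]→L[ℝ] ℝ) :
    V [⋀^Fin (k + m)]→L[ℝ] ℝ :=
  { altWedge α.toAlternatingMap β.toAlternatingMap with
    cont := by
      change Continuous (fun v => altWedge α.toAlternatingMap β.toAlternatingMap v)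
      simp only [altWedge_apply]
      refine continuous_const.mul (continuous_finsetSum _ fun σ _ => Continuous.const_smul ?_ _)
      exact (α.cont.comp (by fun_prop)).mul (β.cont.comp (by fun_prop)) }

/-- A linear form, seen as an alternating `1`-form. -/
def oneForm (f : V →ₗ[ℝ] ℝ) : V [⋀^Fin 1]→ₗ[ℝ] ℝ :=
  AlternatingMap.ofSubsingleton ℝ V ℝ (0 : Fin 1) f

/-- The form `e^{s₁ s₂ … sₖ} = e^{s₁} ∧ … ∧ e^{sₖ}` where `(eⁱ)` is the basis dual to `e`:
its value on `(v₁, …, vₖ)` is the determinant of the matrix `(e^{s_j}(v_i))`.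
The indices are numbered from `0`. -/
def coframe {n k : ℕ} (e : Module.Basis (Fin n) ℝ V) (s : Fin k → Fin n) :
    V [⋀^Fin k]→ₗ[ℝ] ℝ :=
  (Matrix.detRowAlternating (n := Fin k) (R := ℝ)).compLinearMap
    (LinearMap.pi fun j => e.coord (s j))

/-- `ω₀ = e^{14} + e^{25} + e^{36}`. -/
def omegaModel (e : Module.Basis (Fin 6) ℝ V) : V [⋀^Fin 2]→ₗ[ℝ] ℝ :=
  coframe e ![0, 3] + coframe e ![1, 4] + coframe e ![2, 5]

/-- `φ₀ = e^{123} - e^{156} + e^{246} - e^{345}`. -/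
def phiModel (e : Module.Basis (Fin 6) ℝ V) : V [⋀^Fin 3]→ₗ[ℝ] ℝ :=
  coframe e ![0, 1, 2] - coframe e ![0, 4, 5] + coframe e ![1, 3, 5] - coframe e ![2, 3, 4]

/-- `ψ₀ = e^{147} + e^{257} + e^{367} + e^{123} - e^{156} + e^{246} - e^{345}`. -/
def psiModel (e : Module.Basis (Fin 7) ℝ V) : V [⋀^Fin 3]→ₗ[ℝ] ℝ :=
  coframe e ![0, 3, 6] + coframe e ![1, 4, 6] + coframe e ![2, 5, 6] +
    coframe e ![0, 1, 2] - coframe e ![0, 4, 5] + coframe e ![1, 3, 5] - coframe e ![2, 3, 4]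

/-- The endomorphism `K_φ`, determined by `α(K_φ x) = ½ (α ∧ (x ⌟ φ) ∧ φ)(b₁, …, b₆)` for all
linear forms `α`. It takes values in `V ⊗ Λ⁶V*`, and the basis `b` is used to trivialise `Λ⁶V*`. -/
def hitchinK (b : Module.Basis (Fin 6) ℝ V) (φ : V [⋀^Fin 3]→ₗ[ℝ] ℝ) : V →ₗ[ℝ] V :=
  Matrix.toLin b b (Matrix.of fun i j =>
    (1 / 2 : ℝ) *
      (altWedge (oneForm (b.coord i)) (altWedge (AlternatingMap.curryLeft (n := 2) φ (b j)) φ) :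
        V [⋀^Fin 6]→ₗ[ℝ] ℝ) b)

/-- `λ(φ) = (1/6) tr(K_φ²)`, in the trivialisation of `Λ⁶V*` by `b`. -/
def hitchinLambda (b : Module.Basis (Fin 6) ℝ V) (φ : V [⋀^Fin 3]→ₗ[ℝ] ℝ) : ℝ :=
  (1 / 6) * LinearMap.trace ℝ V (hitchinK b φ ∘ₗ hitchinK b φ)

/-- The volume `ε(φ) = √(-λ(φ))`, positive with respect to the orientation of the basis `b`,
in the trivialisation of `Λ⁶V*` by `b`. -/
def hitchinVol (b : Module.Basis (Fin 6) ℝ V) (φ : V [⋀^Fin 3]→ₗ[ℝ] ℝ) : ℝ :=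
  Real.sqrt (-hitchinLambda b φ)

/-- The complex structure `I(φ) = K_φ / ε(φ)`. For a stable `3`-form (of the type of `φ₀`)
it depends on `b` only through the orientation of `b`. -/
def complexStr (b : Module.Basis (Fin 6) ℝ V) (φ : V [⋀^Fin 3]→ₗ[ℝ] ℝ) : V →ₗ[ℝ] V :=
  (hitchinVol b φ)⁻¹ • hitchinK b φ

/-- The value on `v` of the Hodge dual `∗α` of a `k`-form `α`, for the inner product and the
orientation for which the basis `e` is orthonormal and positive:
`(∗α)(v) = (1/k!) ∑ i₁ … iₖ, α(e_{i₁}, …, e_{iₖ}) vol(e_{i₁}, …, e_{iₖ}, v₁, …, vₘ)`. -/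
def hodgeStar {k m : ℕ} (e : Module.Basis (Fin (k + m)) ℝ V) (α : V [⋀^Fin k]→ₗ[ℝ] ℝ)
    (v : Fin m → V) : ℝ :=
  ((k.factorial : ℝ)⁻¹) *
    ∑ i : Fin k → Fin (k + m), α (fun a => e (i a)) * e.det (Fin.append (fun a => e (i a)) v)

end LinearAlgebra

/-! ### Differential forms on manifolds -/

section Forms

variable {E : Type*} [NormedAddCommGroup E] [NormedSpace ℝ E]
  {H : Type*} [TopologicalSpace H] (I : ModelWithCorners ℝ E H)
  {M : Type*} [TopologicalSpace M] [ChartedSpace H M]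
  {E' : Type*} [NormedAddCommGroup E'] [NormedSpace ℝ E']
  {H' : Type*} [TopologicalSpace H'] (I' : ModelWithCorners ℝ E' H')
  {N : Type*} [TopologicalSpace N] [ChartedSpace H' N]

variable (M) in
/-- Real-valued differential `k`-forms on `M` (no smoothness is required here). -/
abbrev DiffForm (k : ℕ) : Type _ := ∀ x : M, TangentSpace I x [⋀^Fin k]→L[ℝ] ℝ

/-- The pull-back `f^* η`. -/
def pullback (f : N → M) {k : ℕ} (η : DiffForm I M k) : DiffForm I' N k :=
  fun y => (η (f y)).compContinuousLinearMap (mfderiv I' I f y)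

/-- The differential of a real function, as a `1`-form. -/
def dFun (f : M → ℝ) : DiffForm I M 1 :=
  fun x => ContinuousAlternatingMap.ofSubsingleton ℝ (TangentSpace I x) ℝ (0 : Fin 1)
    (mfderiv I 𝓘(ℝ, ℝ) f x : TangentSpace I x →L[ℝ] ℝ)

/-- The expression of the form `η` in the preferred chart at `x₀`: the pull-back of `η` by the
inverse of the chart, a form on the model vector space. -/
def chartForm {k : ℕ} (η : DiffForm I M k) (x₀ : M) : E → E [⋀^Fin k]→L[ℝ] ℝ :=
  fun y => (η ((extChartAt I x₀).symm y)).compContinuousLinearMap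
    (mfderivWithin 𝓘(ℝ, E) I (extChartAt I x₀).symm (Set.range I) y :
      E →L[ℝ] TangentSpace I ((extChartAt I x₀).symm y))

/-- A differential form is smooth if it is smooth in the charts. -/
def IsSmoothForm {k : ℕ} (η : DiffForm I M k) : Prop :=
  ∀ x₀ : M, ContDiffOn ℝ ((⊤ : ℕ∞) : WithTop ℕ∞) (chartForm I η x₀) (extChartAt I x₀).target

/-- The exterior derivative: at `x` it is computed in the preferred chart at `x`. -/
def extD {k : ℕ} (η : DiffForm I M k) : DiffForm I M (k + 1) :=
  fun x => (extDerivWithin (chartForm I η x) (Set.range I)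
    (extChartAt I x x)).compContinuousLinearMap
      (mfderiv I 𝓘(ℝ, E) (extChartAt I x) x : TangentSpace I x →L[ℝ] E)

end Forms

/-! ### `SU(3)`-structures on `6`-manifolds -/

section SU3

variable {M : Type*} [TopologicalSpace M] [ChartedSpace (EuclideanSpace ℝ (Fin 6)) M]

instance (x : M) : FiniteDimensional ℝ (TangentSpace (𝓡 6) x) :=
  inferInstanceAs (FiniteDimensional ℝ (EuclideanSpace ℝ (Fin 6)))

instance (x : M) : T2Space (TangentSpace (𝓡 6) x) :=
  inferInstanceAs (T2Space (EuclideanSpace ℝ (Fin 6)))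

theorem card_eq_finrank_tangentSpace (x : M) :
    Fintype.card (Fin 6) = Module.finrank ℝ (TangentSpace (𝓡 6) x) :=
  (finrank_euclideanSpace (𝕜 := ℝ) (ι := Fin 6)).symm

variable (M) in
/-- A choice of orientation of every tangent space of `M`. -/
abbrev TangentOrientation : Type _ :=
  ∀ x : M, Orientation ℝ (TangentSpace (𝓡 6) x) (Fin 6)

/-- The almost complex structure `I(φ)` of a `3`-form on an oriented `6`-manifold; `I(φ)` is
computed in some positively oriented basis of the tangent space. -/
def almostComplex (o : TangentOrientation M) (φ : DiffForm (𝓡 6) M 3) (x : M) :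
    TangentSpace (𝓡 6) x →L[ℝ] TangentSpace (𝓡 6) x :=
  LinearMap.toContinuousLinearMap
    (complexStr ((o x).someBasis (card_eq_finrank_tangentSpace x)) (φ x).toAlternatingMap)

/-- The form `φ̂ = -I(φ).φ`. Since `(A.φ)(X, Y, Z) = φ(A⁻¹X, A⁻¹Y, A⁻¹Z)` and `I(φ)⁻¹ = -I(φ)`,
this is `φ̂(X, Y, Z) = φ(I(φ)X, I(φ)Y, I(φ)Z)`. -/
def hat (o : TangentOrientation M) (φ : DiffForm (𝓡 6) M 3) : DiffForm (𝓡 6) M 3 :=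
  fun x => (φ x).compContinuousLinearMap (almostComplex o φ x)

/-- `(ω, φ)` is an `SU(3)`-structure on the oriented manifold `M`: the forms are smooth, and every
tangent space has a positively oriented basis in which `(ω, φ)` is the model pair `(ω₀, φ₀)`, whose
common stabiliser in `GL(6, ℝ)` is `SU(3)`. -/
structure IsSU3Structure (o : TangentOrientation M) (ω : DiffForm (𝓡 6) M 2)
    (φ : DiffForm (𝓡 6) M 3) : Prop where
  smooth_omega : IsSmoothForm (𝓡 6) ω
  smooth_phi : IsSmoothForm (𝓡 6) φ
  exists_frame : ∀ x : M, ∃ e : Module.Basis (Fin 6) ℝ (TangentSpace (𝓡 6) x),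
    e.orientation = o x ∧
      (ω x).toAlternatingMap = omegaModel e ∧ (φ x).toAlternatingMap = phiModel e

/-- The metric `g(X, Y) = ω(X, I(φ)Y)` of an `SU(3)`-structure. -/
def su3Metric (o : TangentOrientation M) (ω : DiffForm (𝓡 6) M 2) (φ : DiffForm (𝓡 6) M 3)
    (x : M) : LinearMap.BilinForm ℝ (TangentSpace (𝓡 6) x) :=
  LinearMap.mk₂ ℝ (fun X Y => ω x ![X, almostComplex o φ x Y])
    (fun X X' Y => (ω x).toAlternatingMap.map_vecCons_add ![almostComplex o φ x Y] X X')
    (fun c X Y => (ω x).toAlternatingMap.map_vecCons_smul ![almostComplex o φ x Y] c X)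
    (fun X Y Y' => by
      have h := (ω x).toAlternatingMap.map_update_add ![X, 0] 1 (almostComplex o φ x Y)
        (almostComplex o φ x Y')
      have hu (Z : TangentSpace (𝓡 6) x) : Function.update ![X, 0] 1 Z = ![X, Z] := by
        ext i; fin_cases i <;> rfl
      simp only [hu] at h
      rw [map_add]
      exact h)
    (fun c X Y => by
      have h := (ω x).toAlternatingMap.map_update_smul ![X, 0] 1 c (almostComplex o φ x Y)
      have hu (Z : TangentSpace (𝓡 6) x) : Function.update ![X, 0] 1 Z = ![X, Z] := by
        ext i; fin_cases i <;> rfl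
      simp only [hu] at h
      rw [map_smul]
      exact h)

/-- Nearly Kähler structures: `SU(3)`-structures with `dω = 3φ` and `dφ̂ + 2 ω ∧ ω = 0`. -/
structure IsNearlyKahler (o : TangentOrientation M) (ω : DiffForm (𝓡 6) M 2)
    (φ : DiffForm (𝓡 6) M 3) : Prop where
  isSU3Structure : IsSU3Structure o ω φ
  d_omega : ∀ x : M, extD (𝓡 6) ω x = (3 : ℝ) • φ x
  d_hat : ∀ x : M, extD (𝓡 6) (hat o φ) x + (2 : ℝ) • wedge (ω x) (ω x) = 0

end SU3

/-! ### `G₂`-structures on `7`-manifolds -/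

section G2

variable {E : Type*} [NormedAddCommGroup E] [NormedSpace ℝ E]
  {H : Type*} [TopologicalSpace H] (I : ModelWithCorners ℝ E H)
  {N : Type*} [TopologicalSpace N] [ChartedSpace H N]

/-- `e` is a frame at `p` adapted to `ψ`: in this basis of the tangent space, `ψ` is `ψ₀`. -/
def IsG2Frame (ψ : DiffForm I N 3) (p : N) (e : Module.Basis (Fin 7) ℝ (TangentSpace I p)) :
    Prop :=
  (ψ p).toAlternatingMap = psiModel e

/-- `ψ` is a `G₂`-structure: it is smooth, and there are adapted frames at every point. -/
structure IsG2Structure (ψ : DiffForm I N 3) : Prop where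
  smooth : IsSmoothForm I ψ
  exists_frame : ∀ p : N, ∃ e : Module.Basis (Fin 7) ℝ (TangentSpace I p), IsG2Frame I ψ p e

/-- `ĝ` is the metric of the `G₂`-structure `ψ`: the adapted frames are orthonormal for `ĝ`. -/
def IsG2Metric (ψ : DiffForm I N 3)
    (ĝ : ∀ p : N, LinearMap.BilinForm ℝ (TangentSpace I p)) : Prop :=
  ∀ (p : N) (e : Module.Basis (Fin 7) ℝ (TangentSpace I p)), IsG2Frame I ψ p e →
    ∀ i j, ĝ p (e i) (e j) = if i = j then 1 else 0

/-- `ψ` is a nearly parallel `G₂`-structure: `dψ = c ∗ψ` for some real constant `c ≠ 0`. The Hodge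
star is that of the metric and the orientation induced by `ψ`, for which the adapted frames are
orthonormal and positive. -/
def IsNearlyParallel (ψ : DiffForm I N 3) : Prop :=
  IsG2Structure I ψ ∧ ∃ c : ℝ, c ≠ 0 ∧
    ∀ (p : N) (e : Module.Basis (Fin 7) ℝ (TangentSpace I p)), IsG2Frame I ψ p e →
      ∀ v : Fin 4 → TangentSpace I p,
        extD I ψ p v = c * hodgeStar (k := 3) (m := 4) e (ψ p).toAlternatingMap v

end G2

/-! ### The product `M × (0, π)` -/

section Cone

/-- The open interval `(0, π)`, as an open submanifold of `ℝ`. -/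
abbrev coneInterval : TopologicalSpace.Opens ℝ := ⟨Set.Ioo 0 Real.pi, isOpen_Ioo⟩

/-- The model with corners of the product `M × (0, π)`. -/
abbrev coneModel := (𝓡 6).prod 𝓘(ℝ, ℝ)

variable {M : Type*} [TopologicalSpace M] [ChartedSpace (EuclideanSpace ℝ (Fin 6)) M]

variable (M) in
/-- The `1`-form `dt` on `M × (0, π)`. -/
def dt : DiffForm coneModel (M × coneInterval) 1 :=
  dFun coneModel (fun p : M × coneInterval => (p.2 : ℝ))

/-- The `3`-form `ψ = ω_t ∧ dt + φ_t` on `M × (0, π)` of families `ω_t` and `φ_t` of forms on `M`.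
-/
def liftForm (ω : ℝ → DiffForm (𝓡 6) M 2) (φ : ℝ → DiffForm (𝓡 6) M 3) :
    DiffForm coneModel (M × coneInterval) 3 :=
  fun p =>
    (wedge (pullback (𝓡 6) coneModel Prod.fst (ω p.2) p) (dt M p) :
      TangentSpace coneModel p [⋀^Fin 3]→L[ℝ] ℝ) +
    pullback (𝓡 6) coneModel Prod.fst (φ p.2) p

/-- `ω_t = sin²(t) ω`. -/
def sineOmega (ω : DiffForm (𝓡 6) M 2) (t : ℝ) : DiffForm (𝓡 6) M 2 :=
  fun x => (Real.sin t) ^ 2 • ω x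

/-- `φ_t = sin³(t) (sin(t) φ̂ + cos(t) φ)`. -/
def sinePhi (o : TangentOrientation M) (φ : DiffForm (𝓡 6) M 3) (t : ℝ) : DiffForm (𝓡 6) M 3 :=
  fun x => (Real.sin t) ^ 3 • (Real.sin t • hat o φ x + Real.cos t • φ x)

/-- The bilinear form `sin²(t) g + dt²` on `M × (0, π)`, where `g` is the metric of the
`SU(3)`-structure `(ω, φ)` on `M`. -/
def sineConeMetric (o : TangentOrientation M) (ω : DiffForm (𝓡 6) M 2)
    (φ : DiffForm (𝓡 6) M 3) (p : M × coneInterval) :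
    LinearMap.BilinForm ℝ (TangentSpace coneModel p) :=
  let π : TangentSpace coneModel p →L[ℝ] TangentSpace (𝓡 6) p.1 :=
    mfderiv coneModel (𝓡 6) Prod.fst p
  let τ : TangentSpace coneModel p →L[ℝ] ℝ :=
    mfderiv coneModel 𝓘(ℝ, ℝ) (fun q : M × coneInterval => (q.2 : ℝ)) p
  (Real.sin p.2) ^ 2 • (su3Metric o ω φ p.1).compl₁₂ π.toLinearMap π.toLinearMap +
    (LinearMap.mul ℝ ℝ).compl₁₂ τ.toLinearMap τ.toLinearMap

end Cone

end SineCone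

end

/-! At a point, choose a frame adapted to `(ω, φ)` and set `z¹ = e¹ + i e⁴`, `z² = e² + i e⁵`, `z³ =
e³ + i e⁶`, `Ω = z¹ ∧ z² ∧ z³`. Then `φ = Re Ω`, and `I` acts on each `zʲ` as multiplication by `i`,
so `φ̂ = Re (i³ Ω)(-1)² ... = Re (-i Ω) = Im Ω`, that is `Ω = φ + i φ̂`. Hence `φ_t` is the real
part of `sin³(t) e^{-it} Ω`: multiplying `z¹` by `e^{-it}` and then all coframe vectors by `sin t`
gives a frame adapted to `(ω_t, φ_t)`. Its metric is `sin²(t) g`, and adding `dt` gives a frame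
adapted to `ψ` (`phiModel_rotateBasis`, `liftForm_eq_psiModel_sineConeBasis`).

A `G₂`-form determines its metric and orientation, since `(x ⌟ ψ) ∧ (y ⌟ ψ) ∧ ψ = -6 g(x, y) vol` in
every adapted frame. Therefore one explicit frame suffices both for the metric and for the Hodge
star (`basisInner_eq_and_det_eq_of_psiModel_eq`, `hodgeStar_eq_of_basisInner_eq`).

In that frame `∗ψ = -½ ω_t ∧ ω_t - φ̂_t ∧ dt` with `φ̂_t = sin³(t) (cos(t) φ̂ - sin(t) φ)`. The
nearly Kähler equations give `dω = 3φ`, hence `dφ = 0`, and `dφ̂ = -2 ω ∧ ω`. So `dψ = 3 sin² φ ∧ dt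
- 2 sin⁴ ω ∧ ω - ∂_t φ_t ∧ dt`, and `cos² + sin² = 1` turns this into `4 ∗ψ`
(`IsNearlyKahler.extD_sineCone`).

Two analytic points remain. Smoothness of `φ̂` follows from `ω³ φ̂(x, y, z) = 3 φ(·, y, z) ∧ (x ⌟ φ)
∧ φ`, which exhibits `φ̂` as a quotient with nonvanishing denominator (`cube_mul_phiHatModel`). The
exterior derivative, defined at each point in the chart at that point, has to be computed in one
fixed chart before `d² = 0` can be used (`chartForm_extD`). -/

noncomputable section

namespace SineCone

/-! ### Wedge products, contractions and signs of coordinate forms -/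

section Coframe

variable {V : Type*} [AddCommGroup V] [Module ℝ V] {n k m : ℕ}

theorem alternatingMap_sum_apply {ι κ : Type*} (s : Finset κ) (f : κ → V [⋀^ι]→ₗ[ℝ] ℝ)
    (v : ι → V) : (∑ a ∈ s, f a) v = ∑ a ∈ s, f a v := by
  classical
  induction s using Finset.induction_on with
  | empty => simp
  | insert a s ha ih => rw [Finset.sum_insert ha, Finset.sum_insert ha, AlternatingMap.add_apply, ih]

theorem coframe_apply (e : Module.Basis (Fin n) ℝ V) (s : Fin k → Fin n) (v : Fin k → V) :
    coframe e s v = Matrix.det (Matrix.of fun i j => e.coord (s j) (v i)) := rfl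

theorem coframe_two (e : Module.Basis (Fin n) ℝ V) (i j : Fin n) (v : Fin 2 → V) :
    coframe e ![i, j] v =
      e.coord i (v 0) * e.coord j (v 1) - e.coord j (v 0) * e.coord i (v 1) := by
  simp [coframe_apply, Matrix.det_fin_two]

theorem coframe_three (e : Module.Basis (Fin n) ℝ V) (i j l : Fin n) (v : Fin 3 → V) :
    coframe e ![i, j, l] v =
      e.coord i (v 0) * e.coord j (v 1) * e.coord l (v 2) -
      e.coord i (v 0) * e.coord l (v 1) * e.coord j (v 2) -
      e.coord j (v 0) * e.coord i (v 1) * e.coord l (v 2) +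
      e.coord j (v 0) * e.coord l (v 1) * e.coord i (v 2) +
      e.coord l (v 0) * e.coord i (v 1) * e.coord j (v 2) -
      e.coord l (v 0) * e.coord j (v 1) * e.coord i (v 2) := by
  simp [coframe_apply, Matrix.det_fin_three]

/-- The wedge product as a bilinear map. -/
def altWedgeBilin (k m : ℕ) :
    (V [⋀^Fin k]→ₗ[ℝ] ℝ) →ₗ[ℝ] (V [⋀^Fin m]→ₗ[ℝ] ℝ) →ₗ[ℝ] (V [⋀^Fin (k + m)]→ₗ[ℝ] ℝ) :=
  LinearMap.mk₂ ℝ altWedge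
    (fun α α' β => by
      ext v
      simp only [altWedge_apply, AlternatingMap.add_apply, add_mul, smul_add,
        Finset.sum_add_distrib, mul_add])
    (fun c α β => by
      ext v
      simp only [altWedge_apply, AlternatingMap.smul_apply, smul_eq_mul, Finset.mul_sum]
      refine Finset.sum_congr rfl fun σ _ => ?_
      simp only [Units.smul_def, zsmul_eq_mul]
      ring)
    (fun α β β' => by
      ext v
      simp only [altWedge_apply, AlternatingMap.add_apply, mul_add, smul_add,
        Finset.sum_add_distrib])
    (fun c α β => by
      ext v
      simp only [altWedge_apply, AlternatingMap.smul_apply, smul_eq_mul, Finset.mul_sum]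
      refine Finset.sum_congr rfl fun σ _ => ?_
      simp only [Units.smul_def, zsmul_eq_mul]
      ring)

theorem altWedgeBilin_apply (α : V [⋀^Fin k]→ₗ[ℝ] ℝ) (β : V [⋀^Fin m]→ₗ[ℝ] ℝ) :
    altWedgeBilin k m α β = altWedge α β := rfl

/-- Expand both determinants over `τ₁` and `τ₂`. For each of the `k! m!` pairs, the sum over `σ` is
the Leibniz expansion of the full determinant, so the normalising factor cancels exactly. -/
theorem altWedge_coframe (e : Module.Basis (Fin n) ℝ V) (s : Fin k → Fin n) (t : Fin m → Fin n) :
    altWedge (coframe e s) (coframe e t) = coframe e (Fin.append s t) := by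
  ext v
  set M : Matrix (Fin (k + m)) (Fin (k + m)) ℝ :=
    Matrix.of fun i j => e.coord (Fin.append s t j) (v i) with hM
  have key (τ₁ : Equiv.Perm (Fin k)) (τ₂ : Equiv.Perm (Fin m)) :
      ∑ σ : Equiv.Perm (Fin (k + m)), (Equiv.Perm.sign σ : ℝ) *
        (((Equiv.Perm.sign τ₁ : ℝ) * ∏ i, M (σ (Fin.castAdd m (τ₁ i))) (Fin.castAdd m i)) *
          ((Equiv.Perm.sign τ₂ : ℝ) * ∏ i, M (σ (Fin.natAdd k (τ₂ i))) (Fin.natAdd k i))) =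
      M.det := by
    -- The block permutation `τ₁ ⊕ τ₂` is absorbed by the substitution `σ ↦ σ τ`, and its sign is
    -- the product of the two signs.
    set τ : Equiv.Perm (Fin (k + m)) := finSumFinEquiv.permCongr (Equiv.sumCongr τ₁ τ₂) with hτ
    have hs : Equiv.Perm.sign τ = Equiv.Perm.sign τ₁ * Equiv.Perm.sign τ₂ := by
      rw [hτ, Equiv.Perm.sign_permCongr]
      exact Equiv.Perm.sign_sumCongr τ₁ τ₂
    rw [Matrix.det_apply']
    refine Fintype.sum_equiv (Equiv.mulRight τ) _ _ fun σ => ?_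
    simp only [Equiv.coe_mulRight, Equiv.Perm.sign_mul, hs, Fin.prod_univ_add, Equiv.Perm.mul_apply]
    have h1 (i) : τ (Fin.castAdd m i) = Fin.castAdd m (τ₁ i) := by simp [hτ]
    have h2 (i) : τ (Fin.natAdd k i) = Fin.natAdd k (τ₂ i) := by simp [hτ]
    have h3 : ∏ i, M (σ (Fin.castAdd m (τ₁ i))) (Fin.castAdd m i) =
        ∏ i, M ((σ * τ) (Fin.castAdd m i)) (Fin.castAdd m i) := by
      simp only [Equiv.Perm.mul_apply, h1]
    have h4 : ∏ i, M (σ (Fin.natAdd k (τ₂ i))) (Fin.natAdd k i) =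
        ∏ i, M ((σ * τ) (Fin.natAdd k i)) (Fin.natAdd k i) := by
      simp only [Equiv.Perm.mul_apply, h2]
    simp only [Equiv.Perm.mul_apply] at h3 h4
    rw [h3, h4]
    push_cast
    ring
  have hk : (k.factorial : ℝ) ≠ 0 := by positivity
  have hm : (m.factorial : ℝ) ≠ 0 := by positivity
  rw [altWedge_apply, coframe_apply]
  change _ = M.det
  have hl (σ : Equiv.Perm (Fin (k + m))) :
      coframe e s (fun i => v (σ (Fin.castAdd m i))) =
        ∑ τ₁ : Equiv.Perm (Fin k), (Equiv.Perm.sign τ₁ : ℝ) *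
          ∏ i, M (σ (Fin.castAdd m (τ₁ i))) (Fin.castAdd m i) := by
    rw [coframe_apply, Matrix.det_apply']
    simp [hM]
  have hr (σ : Equiv.Perm (Fin (k + m))) :
      coframe e t (fun i => v (σ (Fin.natAdd k i))) =
        ∑ τ₁ : Equiv.Perm (Fin m), (Equiv.Perm.sign τ₁ : ℝ) *
          ∏ i, M (σ (Fin.natAdd k (τ₁ i))) (Fin.natAdd k i) := by
    rw [coframe_apply, Matrix.det_apply']
    simp [hM]
  have hsum : ∑ σ : Equiv.Perm (Fin (k + m)), Equiv.Perm.sign σ •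
      (coframe e s (fun i => v (σ (Fin.castAdd m i))) *
        coframe e t (fun i => v (σ (Fin.natAdd k i)))) =
      ∑ _τ₁ : Equiv.Perm (Fin k), ∑ _τ₂ : Equiv.Perm (Fin m), M.det := by
    have hterm (σ : Equiv.Perm (Fin (k + m))) : Equiv.Perm.sign σ •
        (coframe e s (fun i => v (σ (Fin.castAdd m i))) *
          coframe e t (fun i => v (σ (Fin.natAdd k i)))) =
        ∑ τ₁ : Equiv.Perm (Fin k), ∑ τ₂ : Equiv.Perm (Fin m), (Equiv.Perm.sign σ : ℝ) *
        (((Equiv.Perm.sign τ₁ : ℝ) * ∏ i, M (σ (Fin.castAdd m (τ₁ i))) (Fin.castAdd m i)) *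
          ((Equiv.Perm.sign τ₂ : ℝ) * ∏ i, M (σ (Fin.natAdd k (τ₂ i))) (Fin.natAdd k i))) := by
      rw [hl, hr, Finset.sum_mul_sum, Units.smul_def, zsmul_eq_mul, Finset.mul_sum]
      exact Finset.sum_congr rfl fun τ₁ _ => Finset.mul_sum _ _ _
    rw [Finset.sum_congr rfl fun σ _ => hterm σ, Finset.sum_comm]
    refine Finset.sum_congr rfl fun τ₁ _ => ?_
    rw [Finset.sum_comm]
    exact Finset.sum_congr rfl fun τ₂ _ => key τ₁ τ₂
  rw [hsum]
  simp only [Finset.sum_const, Finset.card_univ, Fintype.card_perm, Fintype.card_fin, nsmul_eq_mul]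
  field_simp

theorem oneForm_coord (e : Module.Basis (Fin n) ℝ V) (i : Fin n) :
    oneForm (e.coord i) = coframe e ![i] := by
  ext v
  simp [oneForm, coframe_apply]

theorem curryLeft_coframe (e : Module.Basis (Fin n) ℝ V) (s : Fin (k + 1) → Fin n) (x : V) :
    (coframe e s).curryLeft x =
      ∑ a : Fin (k + 1), ((-1) ^ (a : ℕ) * e.coord (s a) x) • coframe e (s ∘ a.succAbove) := by
  ext v
  rw [AlternatingMap.curryLeft_apply_apply, coframe_apply, Matrix.det_succ_row_zero,
    alternatingMap_sum_apply]
  refine Finset.sum_congr rfl fun a _ => ?_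
  simp only [AlternatingMap.smul_apply, coframe_apply, smul_eq_mul]
  congr 1

/-- The sign of a sequence: `0` if it has a repetition, and otherwise `1` or `-1` according to the
parity of its inversions. -/
def seqSign (s : Fin k → Fin n) : ℤ :=
  ∏ i, ∏ j ∈ Finset.Ioi i, if s i < s j then 1 else if s i = s j then 0 else -1

/-- If `s` is injective the matrix is a permutation matrix, whose sign counts inversions; a
repetition produces two equal columns. -/
theorem coframe_self (e : Module.Basis (Fin n) ℝ V) (s : Fin n → Fin n) :
    coframe e s e = (seqSign s : ℝ) := by
  by_cases hs : Function.Injective s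
  · let σ : Equiv.Perm (Fin n) := Equiv.ofBijective s (Finite.injective_iff_bijective.1 hs)
    have h1 : coframe e s e = (Equiv.Perm.sign σ : ℝ) := by
      rw [← Matrix.det_permutation, coframe_apply, ← Matrix.det_transpose]
      congr 1
      ext i j
      simp [σ, PEquiv.toMatrix_apply, Finsupp.single_apply, Equiv.toPEquiv, eq_comm]
    rw [h1, Equiv.Perm.sign_eq_prod_prod_Ioi, seqSign]
    push_cast
    refine Finset.prod_congr rfl fun i _ => Finset.prod_congr rfl fun j hj => ?_
    have : s i ≠ s j := fun h => (Finset.mem_Ioi.1 hj).ne (hs h)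
    simp only [σ, Equiv.ofBijective_apply, this, if_false]
    split_ifs <;> simp
  · rw [Function.Injective] at hs
    push Not at hs
    obtain ⟨i, j, hij, hne⟩ := hs
    have h0 : seqSign s = 0 := by
      rw [seqSign]
      rcases lt_or_gt_of_ne hne with h | h
      · exact Finset.prod_eq_zero (Finset.mem_univ i)
          (Finset.prod_eq_zero (Finset.mem_Ioi.2 h) (by simp [hij]))
      · exact Finset.prod_eq_zero (Finset.mem_univ j)
          (Finset.prod_eq_zero (Finset.mem_Ioi.2 h) (by simp [hij]))
    rw [h0, coframe_apply, Matrix.det_zero_of_column_eq hne (fun r => by simp [hij])]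
    simp

/-- The `k`-form `∑ a, c a • coframe e (S a)`. -/
def sumForm {κ : Type*} [Fintype κ] (e : Module.Basis (Fin n) ℝ V) (c : κ → ℤ)
    (S : κ → Fin k → Fin n) : V [⋀^Fin k]→ₗ[ℝ] ℝ :=
  ∑ a, (c a : ℝ) • coframe e (S a)

variable {κ κ' : Type*} [Fintype κ] [Fintype κ']

theorem sumForm_apply (e : Module.Basis (Fin n) ℝ V) (c : κ → ℤ) (S : κ → Fin k → Fin n)
    (v : Fin k → V) : sumForm e c S v = ∑ a, (c a : ℝ) * coframe e (S a) v := by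
  simp [sumForm, alternatingMap_sum_apply]

theorem altWedge_sumForm (e : Module.Basis (Fin n) ℝ V) (c : κ → ℤ) (S : κ → Fin k → Fin n)
    (d : κ' → ℤ) (T : κ' → Fin m → Fin n) :
    altWedge (sumForm e c S) (sumForm e d T) =
      sumForm e (fun a : κ × κ' => c a.1 * d a.2) (fun a => Fin.append (S a.1) (T a.2)) := by
  rw [← altWedgeBilin_apply]
  simp only [sumForm, map_sum, map_smul, LinearMap.sum_apply, LinearMap.smul_apply,
    altWedgeBilin_apply, altWedge_coframe, Finset.smul_sum, smul_smul, Int.cast_mul]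
  rw [Finset.sum_comm, Fintype.sum_prod_type]
  simp only [mul_comm]

/-- The degree `k` is kept separate from `n` because iterated wedges have degrees such as `1 + (2 +
3)`. The test `c a = 0` spares the evaluation of signs that do not contribute. -/
theorem sumForm_self (h : k = n) (e : Module.Basis (Fin n) ℝ V) (c : κ → ℤ)
    (S : κ → Fin k → Fin n) (v : Fin k → V) (hv : v = fun i => e (Fin.cast h i)) :
    sumForm e c S v = ((∑ a, if c a = 0 then 0 else c a * seqSign (S a) : ℤ) : ℝ) := by
  subst h
  rw [sumForm_apply]
  push_cast
  refine Finset.sum_congr rfl fun a _ => ?_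
  split_ifs with h
  · simp [h]
  · rw [← coframe_self e, hv]
    rfl

/-- The nested form discards a whole branch as soon as one coefficient vanishes, which keeps the
finite checks on contractions of the model forms small. -/
theorem sum_prod_ite_eq_zero {κ'' : Type*} [Fintype κ''] (c : κ → ℤ) (d : κ' → ℤ) (f : κ'' → ℤ)
    (g : κ × (κ' × κ'') → ℤ) :
    (∑ a, if c a.1 * (d a.2.1 * f a.2.2) = 0 then 0 else c a.1 * (d a.2.1 * f a.2.2) * g a) =
      ∑ x, if c x = 0 then 0 else ∑ y, if d y = 0 then 0 else
        ∑ z, c x * (d y * f z) * g (x, (y, z)) := by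
  rw [Fintype.sum_prod_type]
  refine Finset.sum_congr rfl fun x _ => ?_
  rw [Fintype.sum_prod_type]
  split_ifs with hx
  · simp [hx]
  refine Finset.sum_congr rfl fun y _ => ?_
  split_ifs with hy
  · simp [hy]
  refine Finset.sum_congr rfl fun z _ => ?_
  split_ifs with hz
  · rw [hz, zero_mul]
  · rfl

/-- The coefficients of the contraction with `e j` of `sumForm e c S`. -/
def curryCoeff (c : κ → ℤ) (S : κ → Fin (k + 1) → Fin n) (j : Fin n) (a : κ × Fin (k + 1)) : ℤ :=
  if S a.1 a.2 = j then c a.1 * (-1) ^ (a.2 : ℕ) else 0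

/-- The index sets of the contractions of `sumForm e c S`. -/
def curryIndex (S : κ → Fin (k + 1) → Fin n) (a : κ × Fin (k + 1)) : Fin k → Fin n :=
  S a.1 ∘ a.2.succAbove

theorem curryLeft_sumForm (e : Module.Basis (Fin n) ℝ V) (c : κ → ℤ)
    (S : κ → Fin (k + 1) → Fin n) (j : Fin n) :
    (sumForm e c S).curryLeft (e j) =
      sumForm e (curryCoeff c S j) (curryIndex S) := by
  have h : (sumForm e c S).curryLeft = ∑ a, (c a : ℝ) • (coframe e (S a)).curryLeft := by
    simp only [sumForm]
    rw [← AlternatingMap.curryLeftLinearMap_apply]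
    simp only [map_sum, map_smul, AlternatingMap.curryLeftLinearMap_apply]
  rw [h]
  simp only [LinearMap.sum_apply, LinearMap.smul_apply, curryLeft_coframe, Finset.smul_sum,
    smul_smul, sumForm]
  rw [Fintype.sum_prod_type]
  refine Finset.sum_congr rfl fun a _ => Finset.sum_congr rfl fun q _ => ?_
  congr 1
  simp [curryCoeff, Module.Basis.coord_apply, Finsupp.single_apply, eq_comm (a := j)]

theorem oneForm_coord_eq_sumForm (e : Module.Basis (Fin n) ℝ V) (i : Fin n) :
    oneForm (e.coord i) = sumForm e (fun _ : Fin 1 => 1) (fun _ => ![i]) := by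
  simp [oneForm_coord, sumForm]

/-- Forms of top degree are multiples of `e.det`. -/
theorem eq_smul_of_basis (e b : Module.Basis (Fin n) ℝ V) (f : V [⋀^Fin n]→ₗ[ℝ] ℝ) :
    f b = e.det b * f e := by
  conv_lhs => rw [f.eq_smul_basis_det e]
  simp [mul_comm]

/-- One comparison in the computation of `seqSign`; the signs `0, 1, -1` are encoded as
`0, 1, 2`. -/
def signStep (a b r : ℕ) : ℕ :=
  bif Nat.blt a b then r else bif Nat.beq a b then 0 else Nat.mod (Nat.mul 2 r) 3

/-- The sign of a list of natural numbers, encoded as `0, 1, 2`. -/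
def signCode : List ℕ → ℕ
  | [] => 1
  | a :: l => l.foldr (signStep a) (signCode l)

/-- Decoding of signs. -/
def codeSign (r : ℕ) : ℤ := bif Nat.beq r 0 then 0 else bif Nat.beq r 1 then 1 else -1

theorem signStep_spec (a b r : ℕ) (hr : r < 3) : signStep a b r < 3 ∧ codeSign (signStep a b r) =
    (if a < b then 1 else if a = b then 0 else -1) * codeSign r := by
  have h1 : Nat.blt a b = decide (a < b) := by
    rw [Bool.eq_iff_iff]; simp
  have h2 : Nat.beq a b = decide (a = b) := by
    rw [Bool.eq_iff_iff]; simp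
  rw [signStep, h1, h2]
  by_cases h : a < b
  · simp [h, hr]
  by_cases h' : a = b
  · simp [h', codeSign]
  · simp only [h, h', decide_false, cond_false, if_false]
    interval_cases r <;> decide

/-- The code works modulo 3, with `2` standing for `-1`: doubling exchanges `1` and `2` and fixes
`0`. Signs thus become natural number arithmetic, which is cheap to evaluate. -/
theorem signCode_ofFn {k n : ℕ} (s : Fin k → Fin n) :
    signCode (List.ofFn fun i => (s i : ℕ)) < 3 ∧
      codeSign (signCode (List.ofFn fun i => (s i : ℕ))) = seqSign s := by
  induction k with
  | zero => exact ⟨by simp [signCode], rfl⟩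
  | succ k ih =>
    have h (a : Fin n) (c : ℕ) (hc : c < 3) (l : ℕ) (t : Fin l → Fin n) :
        (List.ofFn fun i => (t i : ℕ)).foldr (signStep a) c < 3 ∧
          codeSign ((List.ofFn fun i => (t i : ℕ)).foldr (signStep a) c) =
            (∏ j, if a < t j then 1 else if a = t j then 0 else -1) * codeSign c := by
      induction l with
      | zero => simp [hc]
      | succ l ih' =>
        obtain ⟨i1, i2⟩ := ih' (fun i => t i.succ)
        rw [List.ofFn_succ, List.foldr_cons, Fin.prod_univ_succ]
        refine ⟨(signStep_spec _ _ _ i1).1, ?_⟩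
        rw [(signStep_spec _ _ _ i1).2, i2, mul_assoc]
        simp only [Fin.val_inj, Fin.val_fin_lt]
    obtain ⟨i1, i2⟩ := ih (fun i => s i.succ)
    rw [List.ofFn_succ, signCode]
    refine ⟨(h _ _ i1 _ fun i => s i.succ).1, (h _ _ i1 _ fun i => s i.succ).2.trans ?_⟩
    rw [i2, seqSign, seqSign, Fin.prod_univ_succ (n := k), Fin.prod_Ioi_zero]
    simp only [Fin.prod_Ioi_succ]

theorem seqSign_append {k m l n : ℕ} (s : Fin k → Fin n) (t : Fin m → Fin n) (u : Fin l → Fin n) :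
    seqSign (Fin.append s (Fin.append t u)) =
      codeSign (signCode ((List.ofFn fun i => (s i : ℕ)) ++
        ((List.ofFn fun i => (t i : ℕ)) ++ List.ofFn fun i => (u i : ℕ)))) := by
  rw [← (signCode_ofFn _).2, ← List.ofFn_fin_append, ← List.ofFn_fin_append]
  congr 3
  ext i
  refine Fin.addCases (fun i => ?_) (fun i => ?_) i
  · simp
  · refine Fin.addCases (fun i => ?_) (fun i => ?_) i <;> simp

/-- Only the positions at which the index `j` occurs contribute to the contraction; `p` enumerates a
set of positions containing all of them. For `ψ₀` this leaves 3 of 21 terms. -/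
theorem curryLeft_sumForm_of_injective {r : Type*} [Fintype r] (e : Module.Basis (Fin n) ℝ V)
    (c : κ → ℤ) (S : κ → Fin (k + 1) → Fin n) (j : Fin n) (p : r → κ × Fin (k + 1))
    (hp : Function.Injective p) (hS : ∀ a, S a.1 a.2 = j → ∃ x, p x = a) :
    (sumForm e c S).curryLeft (e j) =
      sumForm e (fun x => curryCoeff c S j (p x)) (fun x => curryIndex S (p x)) := by
  rw [curryLeft_sumForm]
  refine (Fintype.sum_of_injective p hp _ _ (fun a ha => ?_) fun x => rfl).symm
  have : S a.1 a.2 ≠ j := fun h => ha (hS a h)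
  simp [curryCoeff, this]

end Coframe

/-! ### The model forms `φ₀` and `ψ₀`, and the endomorphism `K_φ` -/

section Models

variable {V : Type*} [AddCommGroup V] [Module ℝ V] {n k m : ℕ}

/-- The coefficients of `φ₀`. -/
def phiCoeff : Fin 4 → ℤ := ![1, -1, 1, -1]

/-- The index sets of `φ₀`. -/
def phiIndex : Fin 4 → Fin 3 → Fin 6 := ![![0, 1, 2], ![0, 4, 5], ![1, 3, 5], ![2, 3, 4]]

theorem phiModel_eq_sumForm (e : Module.Basis (Fin 6) ℝ V) :
    phiModel e = sumForm e phiCoeff phiIndex := by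
  simp [phiModel, sumForm, Fin.sum_univ_four, phiCoeff, phiIndex]
  module

/-- The coefficients of `ψ₀`. -/
def psiCoeff : Fin 7 → ℤ := ![1, 1, 1, 1, -1, 1, -1]

/-- The index sets of `ψ₀`. -/
def psiIndex : Fin 7 → Fin 3 → Fin 7 :=
  ![![0, 3, 6], ![1, 4, 6], ![2, 5, 6], ![0, 1, 2], ![0, 4, 5], ![1, 3, 5], ![2, 3, 4]]

theorem psiModel_eq_sumForm (e : Module.Basis (Fin 7) ℝ V) :
    psiModel e = sumForm e psiCoeff psiIndex := by
  simp [psiModel, sumForm, Fin.sum_univ_seven, psiCoeff, psiIndex]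
  module

/-- The `6`-form `α ∧ (x ⌟ φ) ∧ φ`. -/
def hitchinForm (φ : V [⋀^Fin 3]→ₗ[ℝ] ℝ) (α : V →ₗ[ℝ] ℝ) (x : V) :
    V [⋀^Fin (1 + (2 + 3))]→ₗ[ℝ] ℝ :=
  altWedge (oneForm α) (altWedge (AlternatingMap.curryLeft (n := 2) φ x) φ)

/-- The value `(α ∧ (x ⌟ φ) ∧ φ)(b₁, …, b₆)`, as a bilinear function of `α` and `x`. -/
def hitchinPairing (φ : V [⋀^Fin 3]→ₗ[ℝ] ℝ) (b : Fin 6 → V) :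
    (V →ₗ[ℝ] ℝ) →ₗ[ℝ] V →ₗ[ℝ] ℝ :=
  LinearMap.mk₂ ℝ (fun α x => altWedgeBilin 1 (2 + 3) (oneForm α)
      (altWedgeBilin 2 3 (AlternatingMap.curryLeft (n := 2) φ x) φ) b)
    (fun f g x => by
      have h : oneForm (f + g) = oneForm f + oneForm g := by ext v; simp [oneForm]
      rw [h, map_add, LinearMap.add_apply, AlternatingMap.add_apply])
    (fun c f x => by
      have h : oneForm (c • f) = c • oneForm f := by ext v; simp [oneForm]
      rw [h, map_smul, LinearMap.smul_apply, AlternatingMap.smul_apply])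
    (fun f x y => by
      rw [map_add, map_add, LinearMap.add_apply, map_add, AlternatingMap.add_apply])
    (fun c f x => by
      rw [map_smul, map_smul, LinearMap.smul_apply, map_smul, AlternatingMap.smul_apply])

theorem hitchinPairing_apply (φ : V [⋀^Fin 3]→ₗ[ℝ] ℝ) (b : Fin 6 → V) (α : V →ₗ[ℝ] ℝ) (x : V) :
    hitchinPairing φ b α x = hitchinForm φ α x b := by
  rw [hitchinPairing, LinearMap.mk₂_apply, hitchinForm, altWedgeBilin_apply, altWedgeBilin_apply]

theorem hitchinForm_apply_eq_det_mul (φ : V [⋀^Fin 3]→ₗ[ℝ] ℝ) (e b : Module.Basis (Fin 6) ℝ V)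
    (α : V →ₗ[ℝ] ℝ) (x : V) : hitchinForm φ α x b = e.det b * hitchinForm φ α x e :=
  eq_smul_of_basis (n := 6) e b _

/-- The matrix defining `K_φ` gives this for `α` in the dual basis and `x` in the basis; bilinearity
of `hitchinPairing` extends it to all arguments. -/
theorem apply_hitchinK (b : Module.Basis (Fin 6) ℝ V) (φ : V [⋀^Fin 3]→ₗ[ℝ] ℝ) (α : V →ₗ[ℝ] ℝ)
    (x : V) : α (hitchinK b φ x) = 1 / 2 * hitchinForm φ α x b := by
  have hi (i : Fin 6) (x : V) :
      b.coord i (hitchinK b φ x) = 1 / 2 * hitchinPairing φ b (b.coord i) x := by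
    have h : b.coord i ∘ₗ hitchinK b φ = (1 / 2 : ℝ) • hitchinPairing φ b (b.coord i) := by
      refine b.ext fun j => ?_
      rw [LinearMap.comp_apply, hitchinK, Matrix.toLin_self, LinearMap.smul_apply,
        hitchinPairing_apply]
      simp [hitchinForm, Finsupp.single_apply]
    simpa using LinearMap.congr_fun h x
  have h : α = ∑ i, α (b i) • b.coord i := by
    refine b.ext fun j => ?_
    simp
  rw [← hitchinPairing_apply, h, LinearMap.sum_apply, map_sum, LinearMap.sum_apply, Finset.mul_sum]
  refine Finset.sum_congr rfl fun i _ => ?_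
  rw [LinearMap.smul_apply, hi, map_smul, LinearMap.smul_apply, smul_eq_mul, smul_eq_mul]
  ring

theorem hitchinK_basis (e b : Module.Basis (Fin 6) ℝ V) (φ : V [⋀^Fin 3]→ₗ[ℝ] ℝ) :
    hitchinK b φ = e.det b • hitchinK e φ := by
  ext x
  refine e.ext_elem fun i => ?_
  have h1 := apply_hitchinK b φ (e.coord i) x
  have h2 := apply_hitchinK e φ (e.coord i) x
  rw [hitchinForm_apply_eq_det_mul φ e b] at h1
  simp only [Module.Basis.coord_apply] at h1 h2
  rw [LinearMap.smul_apply, map_smul, Finsupp.smul_apply, h1, h2, smul_eq_mul]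
  ring

/-- A change of basis multiplies `K_φ` by the determinant and `ε(φ)` by its absolute value, so the
quotient is unchanged exactly when the orientation is kept. This makes the choice of positive basis
in `almostComplex` immaterial. -/
theorem complexStr_basis (e b : Module.Basis (Fin 6) ℝ V) (φ : V [⋀^Fin 3]→ₗ[ℝ] ℝ)
    (h : 0 < e.det b) : complexStr b φ = complexStr e φ := by
  have hv : hitchinVol b φ = e.det b * hitchinVol e φ := by
    rw [hitchinVol, hitchinVol, hitchinLambda, hitchinLambda, hitchinK_basis e b φ,
      ← Real.sqrt_sq h.le, ← Real.sqrt_mul (sq_nonneg _), Real.sqrt_sq h.le]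
    congr 1
    simp only [LinearMap.smul_comp, LinearMap.comp_smul, map_smul, smul_eq_mul]
    ring
  rw [complexStr, complexStr, hv, hitchinK_basis e b φ, smul_smul, mul_inv]
  congr 1
  field_simp

/-- A finite check over 36 pairs. After the factor `½` it says that `K_φ` sends `e_j` to `e_{j+3}`
and `e_{j+3}` to `-e_j`. -/
theorem hitchinForm_phiModel (e : Module.Basis (Fin 6) ℝ V) (i j : Fin 6) :
    hitchinForm (phiModel e) (e.coord i) (e j) e =
      ((if i.val = j.val + 3 then 2 else if j.val = i.val + 3 then -2 else 0 : ℤ) : ℝ) := by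
  rw [hitchinForm, phiModel_eq_sumForm, oneForm_coord_eq_sumForm, curryLeft_sumForm,
    altWedge_sumForm, altWedge_sumForm, sumForm_self (by norm_num) e _ _ e rfl,
    sum_prod_ite_eq_zero (fun _ => 1) (curryCoeff phiCoeff phiIndex j) phiCoeff]
  congr 1
  revert i j
  decide +kernel

/-- The positions of the index `j` in the index sets of `ψ₀`. -/
def psiPos : Fin 7 → Fin 3 → Fin 7 × Fin 3 :=
  ![![(0, 0), (3, 0), (4, 0)],
    ![(1, 0), (3, 1), (5, 0)],
    ![(2, 0), (3, 2), (6, 0)],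
    ![(0, 1), (5, 1), (6, 1)],
    ![(1, 1), (4, 1), (6, 2)],
    ![(2, 1), (4, 2), (5, 2)],
    ![(0, 2), (1, 2), (2, 2)]]

/-- The coefficients of `e_j ⌟ ψ₀`. -/
def psiCurryCoeff (j x : ℕ) : ℤ :=
  ([[1, 1, -1],
    [1, -1, 1],
    [1, 1, -1],
    [-1, -1, 1],
    [-1, 1, -1],
    [-1, -1, 1],
    [1, 1, 1]].getD j []).getD x 0

/-- The index sets of `e_j ⌟ ψ₀`. -/
def psiCurryIndex (j x : ℕ) : List ℕ :=
  ([[[3, 6], [1, 2], [4, 5]],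
    [[4, 6], [0, 2], [3, 5]],
    [[5, 6], [0, 1], [3, 4]],
    [[0, 6], [1, 5], [2, 4]],
    [[1, 6], [0, 5], [2, 3]],
    [[2, 6], [0, 4], [1, 3]],
    [[0, 3], [1, 4], [2, 5]]].getD j []).getD x []

theorem psiCurryCoeff_eq (j : Fin 7) (x : Fin 3) :
    curryCoeff psiCoeff psiIndex j (psiPos j x) = psiCurryCoeff j x := by
  revert j x
  decide +kernel

theorem psiCurryIndex_eq (j : Fin 7) (x : Fin 3) :
    (List.ofFn fun i => (curryIndex psiIndex (psiPos j x) i : ℕ)) = psiCurryIndex j x := by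
  revert j x
  decide +kernel

theorem curryLeft_psiModel (e : Module.Basis (Fin 7) ℝ V) (j : Fin 7) :
    AlternatingMap.curryLeft (n := 2) (psiModel e) (e j) =
      sumForm e (fun x : Fin 3 => psiCurryCoeff j x)
        (fun x => curryIndex psiIndex (psiPos j x)) := by
  have h1 : ∀ j, Function.Injective (psiPos j) := by
    unfold Function.Injective
    decide +kernel
  have h2 : ∀ (j : Fin 7) (a : Fin 7 × Fin 3), psiIndex a.1 a.2 = j → ∃ x, psiPos j x = a := by
    decide +kernel
  rw [psiModel_eq_sumForm, curryLeft_sumForm_of_injective e _ _ j (psiPos j) (h1 j) (h2 j)]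
  simp only [psiCurryCoeff_eq]

/-- The coefficients of `ψ₀`, indexed by natural numbers. -/
def psiListCoeff (z : ℕ) : ℤ := [1, 1, 1, 1, -1, 1, -1].getD z 0

/-- The index sets of `ψ₀`, as lists indexed by natural numbers. -/
def psiList (z : ℕ) : List ℕ :=
  [[0, 3, 6], [1, 4, 6], [2, 5, 6], [0, 1, 2], [0, 4, 5], [1, 3, 5], [2, 3, 4]].getD z []

theorem psiList_eq (z : Fin 7) :
    (List.ofFn fun i => (psiIndex z i : ℕ)) = psiList z ∧ psiCoeff z = psiListCoeff z := by
  revert z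
  decide +kernel

end Models

/-! ### Linear algebra of `SU(3)`-structures -/

section PointwiseSU3

variable {V : Type*} [AddCommGroup V] [Module ℝ V]

theorem coord_hitchinK_phiModel (e : Module.Basis (Fin 6) ℝ V) (x : V) (i : Fin 6) :
    e.coord i (hitchinK e (phiModel e) x) =
      ![-e.coord 3 x, -e.coord 4 x, -e.coord 5 x, e.coord 0 x, e.coord 1 x, e.coord 2 x] i := by
  have hx : x = ∑ j, e.coord j x • e j := by simp [e.sum_repr]
  have h : e.coord i (hitchinK e (phiModel e) x) = ∑ j : Fin 6, e.coord j x *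
      (1 / 2 * ((if i.val = j.val + 3 then 2 else if j.val = i.val + 3 then -2 else 0 : ℤ) : ℝ)) := by
    conv_lhs => rw [hx, map_sum, map_sum]
    refine Finset.sum_congr rfl fun j _ => ?_
    rw [map_smul, map_smul, apply_hitchinK, hitchinForm_phiModel, smul_eq_mul]
  rw [h]
  fin_cases i <;> simp [Fin.sum_univ_six]

/-- Here `K² = -1` on a 6-dimensional space, so `tr K² = -6` and `-λ = 1`. -/
theorem hitchinVol_phiModel (e : Module.Basis (Fin 6) ℝ V) : hitchinVol e (phiModel e) = 1 := by
  have h : hitchinK e (phiModel e) ∘ₗ hitchinK e (phiModel e) = (-1 : ℝ) • LinearMap.id := by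
    ext x
    refine e.ext_elem fun i => ?_
    simp only [← Module.Basis.coord_apply, LinearMap.comp_apply]
    rw [coord_hitchinK_phiModel]
    simp only [coord_hitchinK_phiModel]
    fin_cases i <;> simp
  have := Module.Finite.of_basis e
  rw [hitchinVol, hitchinLambda, h, map_smul, LinearMap.trace_id,
    Module.finrank_eq_card_basis e]
  norm_num

theorem coord_complexStr_phiModel (e : Module.Basis (Fin 6) ℝ V) (x : V) (i : Fin 6) :
    e.coord i (complexStr e (phiModel e) x) =
      ![-e.coord 3 x, -e.coord 4 x, -e.coord 5 x, e.coord 0 x, e.coord 1 x, e.coord 2 x] i := by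
  rw [complexStr, hitchinVol_phiModel, inv_one, one_smul, coord_hitchinK_phiModel]

/-- The imaginary part of `(e¹ + i e⁴) ∧ (e² + i e⁵) ∧ (e³ + i e⁶)`; its real part is `φ₀`. -/
def phiHatModel (e : Module.Basis (Fin 6) ℝ V) : V [⋀^Fin 3]→ₗ[ℝ] ℝ :=
  coframe e ![3, 1, 2] + coframe e ![0, 4, 2] + coframe e ![0, 1, 5] - coframe e ![3, 4, 5]

theorem omegaModel_apply (e : Module.Basis (Fin 6) ℝ V) (v : Fin 2 → V) :
    omegaModel e v = coframe e ![0, 3] v + coframe e ![1, 4] v + coframe e ![2, 5] v := rfl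

theorem phiModel_apply (e : Module.Basis (Fin 6) ℝ V) (v : Fin 3 → V) :
    phiModel e v = coframe e ![0, 1, 2] v - coframe e ![0, 4, 5] v + coframe e ![1, 3, 5] v -
      coframe e ![2, 3, 4] v := rfl

theorem phiHatModel_apply (e : Module.Basis (Fin 6) ℝ V) (v : Fin 3 → V) :
    phiHatModel e v = coframe e ![3, 1, 2] v + coframe e ![0, 4, 2] v + coframe e ![0, 1, 5] v -
      coframe e ![3, 4, 5] v := rfl

/-- Each complex coordinate satisfies `z(Ix) = i z(x)`, so applying `I` in all three slots
multiplies `Ω` by `i³ = -i`, and `Re (-i Ω) = Im Ω`. -/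
theorem phiModel_complexStr (e : Module.Basis (Fin 6) ℝ V) (v : Fin 3 → V) :
    phiModel e (fun i => complexStr e (phiModel e) (v i)) = phiHatModel e v := by
  simp only [phiModel_apply, phiHatModel_apply, coframe_three, coord_complexStr_phiModel]
  simp only [Matrix.cons_val]
  ring

/-- With `I` in a single slot `Ω` is multiplied by `i`, and `Re (i Ω) = -Im Ω`. -/
theorem phiModel_complexStr_left (e : Module.Basis (Fin 6) ℝ V) (x y z : V) :
    phiModel e ![complexStr e (phiModel e) x, y, z] = -phiHatModel e ![x, y, z] := by
  simp only [phiModel_apply, phiHatModel_apply, coframe_three, Matrix.cons_val,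
    coord_complexStr_phiModel]
  ring

theorem omegaModel_complexStr (e : Module.Basis (Fin 6) ℝ V) (x y : V) :
    omegaModel e ![x, complexStr e (phiModel e) y] = ∑ i, e.coord i x * e.coord i y := by
  simp only [omegaModel_apply, coframe_two, Matrix.cons_val, coord_complexStr_phiModel,
    Fin.sum_univ_six]
  ring

/-- The coefficients of `ω₀`. -/
def omegaCoeff : Fin 3 → ℤ := ![1, 1, 1]

/-- The index sets of `ω₀`. -/
def omegaIndex : Fin 3 → Fin 2 → Fin 6 := ![![0, 3], ![1, 4], ![2, 5]]

theorem omegaModel_eq_sumForm (e : Module.Basis (Fin 6) ℝ V) :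
    omegaModel e = sumForm e omegaCoeff omegaIndex := by
  simp [omegaModel, sumForm, Fin.sum_univ_three, omegaCoeff, omegaIndex]

/-- The cube `ω ∧ ω ∧ ω` of a `2`-form. -/
def cube (ω : V [⋀^Fin 2]→ₗ[ℝ] ℝ) : V [⋀^Fin (2 + (2 + 2))]→ₗ[ℝ] ℝ :=
  altWedge ω (altWedge ω ω)

/-- `ω₀³ = 6 e^{142536}`, and the permutation `142536` has three inversions, hence the minus sign.
-/
theorem cube_omegaModel_self (e : Module.Basis (Fin 6) ℝ V) : cube (omegaModel e) e = -6 := by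
  rw [cube, omegaModel_eq_sumForm, altWedge_sumForm, altWedge_sumForm,
    sumForm_self (by norm_num) e _ _ e rfl]
  have : (∑ a : Fin 3 × (Fin 3 × Fin 3),
      if omegaCoeff a.1 * (omegaCoeff a.2.1 * omegaCoeff a.2.2) = 0 then 0 else
        omegaCoeff a.1 * (omegaCoeff a.2.1 * omegaCoeff a.2.2) *
          seqSign (Fin.append (omegaIndex a.1)
            (Fin.append (omegaIndex a.2.1) (omegaIndex a.2.2)))) = -6 := by
    decide +kernel
  rw [this]
  norm_num

theorem cube_apply_eq_det_mul (ω : V [⋀^Fin 2]→ₗ[ℝ] ℝ) (e b : Module.Basis (Fin 6) ℝ V) :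
    cube ω b = e.det b * cube ω e :=
  eq_smul_of_basis (n := 6) e b _

theorem cube_smul (c : ℝ) (ω : V [⋀^Fin 2]→ₗ[ℝ] ℝ) : cube (c • ω) = c ^ 3 • cube ω := by
  simp only [cube, ← altWedgeBilin_apply, map_smul, LinearMap.smul_apply, smul_smul]
  congr 1
  ring

/-- The linear form `φ(·, y, z)`. -/
def evalTail (φ : V [⋀^Fin 3]→ₗ[ℝ] ℝ) (y z : V) : V →ₗ[ℝ] ℝ where
  toFun x := φ ![x, y, z]
  map_add' x x' := φ.map_vecCons_add ![y, z] x x'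
  map_smul' c x := φ.map_vecCons_smul ![y, z] c x

/-- Since `φ̂(x, y, z) = -φ(Ix, y, z)`, taking `α = φ(·, y, z)` in the definition of `K_φ` computes
`φ̂` up to a volume. Using `ω³` as that volume removes the square root and the adapted frame,
leaving expressions polynomial in `ω` and `φ`. -/
theorem cube_mul_phiHatModel (e b : Module.Basis (Fin 6) ℝ V) (x y z : V) :
    cube (omegaModel e) b * phiHatModel e ![x, y, z] =
      3 * hitchinForm (phiModel e) (evalTail (phiModel e) y z) x b := by
  have h := apply_hitchinK b (phiModel e) (evalTail (phiModel e) y z) x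
  have h1 : evalTail (phiModel e) y z (hitchinK e (phiModel e) x) =
      -phiHatModel e ![x, y, z] := by
    rw [← phiModel_complexStr_left, complexStr, hitchinVol_phiModel, inv_one, one_smul]
    rfl
  rw [hitchinK_basis e b, LinearMap.smul_apply, map_smul, h1, smul_eq_mul] at h
  rw [cube_apply_eq_det_mul _ e b, cube_omegaModel_self]
  linarith

/-- The coordinate change which rotates the plane of the coordinates `0, 3` by the angle with
cosine `c` and sine `-d`, and scales everything by `s`. -/
def rotateEquiv (s c d : ℝ) (hs : s ≠ 0) (h : c ^ 2 + d ^ 2 = 1) :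
    (Fin 6 → ℝ) ≃ₗ[ℝ] (Fin 6 → ℝ) where
  toFun x := ![s * (c * x 0 + d * x 3), s * x 1, s * x 2, s * (c * x 3 - d * x 0), s * x 4, s * x 5]
  invFun x := ![s⁻¹ * (c * x 0 - d * x 3), s⁻¹ * x 1, s⁻¹ * x 2, s⁻¹ * (c * x 3 + d * x 0),
    s⁻¹ * x 4, s⁻¹ * x 5]
  map_add' x y := by ext i; fin_cases i <;> simp <;> ring
  map_smul' r x := by ext i; fin_cases i <;> simp <;> ring
  left_inv x := by
    ext i
    fin_cases i <;> simp [hs]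
    · field_simp
      linear_combination x 0 * h
    · field_simp
      linear_combination x 3 * h
  right_inv x := by
    ext i
    fin_cases i <;> simp [hs]
    · field_simp
      linear_combination x 0 * h
    · field_simp
      linear_combination x 3 * h

/-- The frame obtained from `e` by the coordinate change `rotateEquiv`. -/
def rotateBasis (e : Module.Basis (Fin 6) ℝ V) (s c d : ℝ) (hs : s ≠ 0) (h : c ^ 2 + d ^ 2 = 1) :
    Module.Basis (Fin 6) ℝ V :=
  Module.Basis.ofEquivFun (e.equivFun ≪≫ₗ rotateEquiv s c d hs h)

theorem det_fin_four (A : Matrix (Fin 4) (Fin 4) ℝ) :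
    A.det = (
      A 0 0 * A 1 1 * A 2 2 * A 3 3 - A 0 0 * A 1 1 * A 2 3 * A 3 2 - A 0 0 * A 1 2 * A 2 1 * A
      3 3 + A 0 0 * A 1 2 * A 2 3 * A 3 1 + A 0 0 * A 1 3 * A 2 1 * A 3 2 - A 0 0 * A 1 3 * A 2
      2 * A 3 1 - A 0 1 * A 1 0 * A 2 2 * A 3 3 + A 0 1 * A 1 0 * A 2 3 * A 3 2 + A 0 1 * A 1 2
      * A 2 0 * A 3 3 - A 0 1 * A 1 2 * A 2 3 * A 3 0 - A 0 1 * A 1 3 * A 2 0 * A 3 2 + A 0 1 *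
      A 1 3 * A 2 2 * A 3 0 + A 0 2 * A 1 0 * A 2 1 * A 3 3 - A 0 2 * A 1 0 * A 2 3 * A 3 1 - A
      0 2 * A 1 1 * A 2 0 * A 3 3 + A 0 2 * A 1 1 * A 2 3 * A 3 0 + A 0 2 * A 1 3 * A 2 0 * A 3
      1 - A 0 2 * A 1 3 * A 2 1 * A 3 0 - A 0 3 * A 1 0 * A 2 1 * A 3 2 + A 0 3 * A 1 0 * A 2 2
      * A 3 1 + A 0 3 * A 1 1 * A 2 0 * A 3 2 - A 0 3 * A 1 1 * A 2 2 * A 3 0 - A 0 3 * A 1 2 *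
      A 2 0 * A 3 1 + A 0 3 * A 1 2 * A 2 1 * A 3 0) := by
  rw [Matrix.det_succ_row_zero]
  simp only [Fin.sum_univ_four, Matrix.det_fin_three, Matrix.submatrix_apply]
  have h1 : (1 : Fin 4).succAbove = ![0, 2, 3] := by decide
  have h2 : (2 : Fin 4).succAbove = ![0, 1, 3] := by decide
  have h3 : (3 : Fin 4).succAbove = ![0, 1, 2] := by decide
  have h0 : (0 : Fin 4).succAbove = ![1, 2, 3] := by decide
  have h4 : (Fin.succ : Fin 3 → Fin 4) = ![1, 2, 3] := by decide
  rw [h0, h1, h2, h3, h4]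
  simp [-Matrix.cons_val_succ]
  ring

theorem coframe_append_two_two {n : ℕ} (e : Module.Basis (Fin n) ℝ V) (s t : Fin 2 → Fin n)
    (v : Fin (2 + 2) → V) :
    coframe e (Fin.append s t) v =
      coframe e s ![v 0, v 1] * coframe e t ![v 2, v 3] -
      coframe e s ![v 0, v 2] * coframe e t ![v 1, v 3] +
      coframe e s ![v 0, v 3] * coframe e t ![v 1, v 2] +
      coframe e s ![v 1, v 2] * coframe e t ![v 0, v 3] -
      coframe e s ![v 1, v 3] * coframe e t ![v 0, v 2] +
      coframe e s ![v 2, v 3] * coframe e t ![v 0, v 1] := by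
  have h0 : Fin.append s t 0 = s 0 := rfl
  have h1 : Fin.append s t 1 = s 1 := rfl
  have h2 : Fin.append s t 2 = t 0 := rfl
  have h3 : Fin.append s t 3 = t 1 := rfl
  rw [coframe_apply, det_fin_four]
  simp only [coframe_apply, Matrix.det_fin_two, Matrix.of_apply, h0, h1, h2, h3, Matrix.cons_val]
  ring

/-- The six permutations fall into three pairs with equal contributions, cancelling the factor `1 /
(2! 1!)`. -/
theorem altWedge_two_one (α : V [⋀^Fin 2]→ₗ[ℝ] ℝ) (β : V [⋀^Fin 1]→ₗ[ℝ] ℝ)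
    (v : Fin (2 + 1) → V) :
    altWedge α β v = α ![v 0, v 1] * β ![v 2] - α ![v 0, v 2] * β ![v 1] +
      α ![v 1, v 2] * β ![v 0] := by
  have huniv : (Finset.univ : Finset (Equiv.Perm (Fin (2 + 1)))) =
      {1, Equiv.swap 0 1, Equiv.swap 1 2, Equiv.swap 0 2, Equiv.swap 0 1 * Equiv.swap 1 2,
        Equiv.swap 1 2 * Equiv.swap 0 1} := by decide
  have hα (x y : V) : α ![y, x] = -α ![x, y] := by
    rw [← α.map_swap ![x, y] (show (0 : Fin 2) ≠ 1 by decide)]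
    congr 1
    ext i
    fin_cases i <;> rfl
  have ha (σ : Equiv.Perm (Fin (2 + 1))) :
      (fun i : Fin 2 => v (σ (Fin.castAdd 1 i))) = ![v (σ 0), v (σ 1)] := by
    ext i
    fin_cases i <;> rfl
  have hb (σ : Equiv.Perm (Fin (2 + 1))) :
      (fun i : Fin 1 => v (σ (Fin.natAdd 2 i))) = ![v (σ 2)] := by
    ext i
    fin_cases i
    rfl
  rw [altWedge_apply]
  simp only [ha, hb]
  rw [huniv]
  repeat rw [Finset.sum_insert (by decide)]
  rw [Finset.sum_singleton]
  have s1 : Equiv.Perm.sign (Equiv.swap (0 : Fin (2 + 1)) 1) = -1 := by decide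
  have s2 : Equiv.Perm.sign (Equiv.swap (1 : Fin (2 + 1)) 2) = -1 := by decide
  have s3 : Equiv.Perm.sign (Equiv.swap (0 : Fin (2 + 1)) 2) = -1 := by decide
  have e1 : Equiv.swap (0 : Fin (2 + 1)) 1 2 = 2 := by decide
  have e2 : Equiv.swap (1 : Fin (2 + 1)) 2 0 = 0 := by decide
  have e3 : Equiv.swap (0 : Fin (2 + 1)) 2 1 = 1 := by decide
  simp [s1, s2, s3, e1, e2, e3, hα (v 0) (v 1), hα (v 0) (v 2), hα (v 1) (v 2)]
  ring

variable (e : Module.Basis (Fin 6) ℝ V) {s c d : ℝ} (hs : s ≠ 0) (h : c ^ 2 + d ^ 2 = 1)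

theorem coord_rotateBasis (x : V) (i : Fin 6) :
    (rotateBasis e s c d hs h).coord i x =
      ![s * (c * e.coord 0 x + d * e.coord 3 x), s * e.coord 1 x, s * e.coord 2 x,
        s * (c * e.coord 3 x - d * e.coord 0 x), s * e.coord 4 x, s * e.coord 5 x] i := rfl

theorem omegaModel_rotateBasis :
    omegaModel (rotateBasis e s c d hs h) = s ^ 2 • omegaModel e := by
  ext v
  simp only [AlternatingMap.smul_apply, omegaModel_apply, coframe_two, coord_rotateBasis,
    Matrix.cons_val, smul_eq_mul]
  linear_combination s ^ 2 * (e.coord 0 (v 0) * e.coord 3 (v 1) - e.coord 3 (v 0) * e.coord 0 (v 1)) * h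

/-- In complex terms `z¹` is replaced by `s (c - i d) z¹` and `z²`, `z³` by `s z²`, `s z³`. So `Ω`
is multiplied by `s³ (c - i d)`; this is the real part, and `phiHatModel_rotateBasis` the imaginary
part. -/
theorem phiModel_rotateBasis :
    phiModel (rotateBasis e s c d hs h) = s ^ 3 • (d • phiHatModel e + c • phiModel e) := by
  ext v
  simp only [AlternatingMap.smul_apply, AlternatingMap.add_apply, phiModel_apply,
    phiHatModel_apply, coframe_three, coord_rotateBasis, Matrix.cons_val, smul_eq_mul]
  ring

theorem phiHatModel_rotateBasis :
    phiHatModel (rotateBasis e s c d hs h) = s ^ 3 • (c • phiHatModel e - d • phiModel e) := by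
  ext v
  simp only [AlternatingMap.smul_apply, AlternatingMap.sub_apply, phiModel_apply,
    phiHatModel_apply, coframe_three, coord_rotateBasis, Matrix.cons_val, smul_eq_mul]
  ring

/-- The cube of the 2-form detects the orientation: `ω³` takes the value `-6` on each frame adapted
to its own form, and passing from `ω` to `s² ω` multiplies the cube by `s⁶ > 0`. -/
theorem orientation_rotateBasis : (rotateBasis e s c d hs h).orientation = e.orientation := by
  rw [eq_comm, Module.Basis.orientation_eq_iff_det_pos]
  have h1 := cube_omegaModel_self (rotateBasis e s c d hs h)
  rw [omegaModel_rotateBasis, cube_smul, AlternatingMap.smul_apply,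
    cube_apply_eq_det_mul _ e (rotateBasis e s c d hs h), cube_omegaModel_self, smul_eq_mul] at h1
  have h2 : 0 < (s ^ 2) ^ 3 := by positivity
  by_contra hn
  nlinarith [mul_nonneg h2.le (neg_nonneg.2 (not_lt.1 hn))]

/-- The six shuffles of `ω ∧ ω` coincide in pairs, because 2-forms commute. -/
theorem altWedge_omegaModel_self (v : Fin 4 → V) :
    (altWedge (omegaModel e) (omegaModel e) : V [⋀^Fin (2 + 2)]→ₗ[ℝ] ℝ) v =
      2 * (omegaModel e ![v 0, v 1] * omegaModel e ![v 2, v 3] -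
        omegaModel e ![v 0, v 2] * omegaModel e ![v 1, v 3] +
        omegaModel e ![v 0, v 3] * omegaModel e ![v 1, v 2]) := by
  rw [omegaModel_eq_sumForm, altWedge_sumForm, sumForm_apply, Fintype.sum_prod_type]
  simp only [coframe_append_two_two, sumForm_apply, Fin.sum_univ_three]
  simp only [omegaCoeff, Matrix.cons_val]
  push_cast
  ring

end PointwiseSU3

/-! ### The metric, orientation and Hodge star of a `G₂`-form -/

section PointwiseG2

open scoped Matrix

variable {W : Type*} [AddCommGroup W] [Module ℝ W] {n k m : ℕ}

theorem eq_smul_of_basis_cast (h : k = n) (e b : Module.Basis (Fin n) ℝ W)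
    (f : W [⋀^Fin k]→ₗ[ℝ] ℝ) :
    f (fun i => b (Fin.cast h i)) = e.det b * f (fun i => e (Fin.cast h i)) := by
  subst h
  exact eq_smul_of_basis e b f

/-- The value `(A x ∧ B y ∧ γ)(v)`, as a bilinear form in `x` and `y`. -/
def wedgePairing {l : ℕ} (A : W →ₗ[ℝ] W [⋀^Fin k]→ₗ[ℝ] ℝ) (B : W →ₗ[ℝ] W [⋀^Fin m]→ₗ[ℝ] ℝ)
    (γ : W [⋀^Fin l]→ₗ[ℝ] ℝ) (v : Fin (k + (m + l)) → W) : LinearMap.BilinForm ℝ W :=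
  LinearMap.mk₂ ℝ (fun x y => altWedgeBilin k (m + l) (A x) (altWedgeBilin m l (B y) γ) v)
    (fun x y z => by
      rw [map_add, map_add, LinearMap.add_apply, AlternatingMap.add_apply])
    (fun c x z => by
      rw [map_smul, map_smul, LinearMap.smul_apply, AlternatingMap.smul_apply])
    (fun x y z => by
      rw [map_add, map_add, LinearMap.add_apply, map_add, AlternatingMap.add_apply])
    (fun c x y => by
      rw [map_smul, map_smul, LinearMap.smul_apply, map_smul, AlternatingMap.smul_apply])

theorem wedgePairing_apply {l : ℕ} (A : W →ₗ[ℝ] W [⋀^Fin k]→ₗ[ℝ] ℝ)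
    (B : W →ₗ[ℝ] W [⋀^Fin m]→ₗ[ℝ] ℝ) (γ : W [⋀^Fin l]→ₗ[ℝ] ℝ) (v : Fin (k + (m + l)) → W)
    (x y : W) : wedgePairing A B γ v x y = altWedge (A x) (altWedge (B y) γ) v := rfl

/-- The value `((x ⌟ ψ) ∧ (y ⌟ ψ) ∧ ψ)(b₁, …, b₇)`, as a bilinear form. -/
def bryantPairing (ψ : W [⋀^Fin 3]→ₗ[ℝ] ℝ) (b : Fin 7 → W) : LinearMap.BilinForm ℝ W :=
  wedgePairing (k := 2) (m := 2) (l := 3) (AlternatingMap.curryLeft (n := 2) ψ)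
    (AlternatingMap.curryLeft (n := 2) ψ) ψ (fun i => b (Fin.cast (by norm_num) i))

-- A finite check over 49 pairs of basis vectors, each a sum of `3 · 3 · 7` signs. The value `-6`
-- rather than `6` reflects the orientation convention of `ψ₀`; only that it is nonzero matters
-- later.
set_option maxRecDepth 10000 in
theorem bryantPairing_psiModel_apply (e : Module.Basis (Fin 7) ℝ W) (i j : Fin 7) :
    bryantPairing (psiModel e) e (e i) (e j) = ((if i = j then -6 else 0 : ℤ) : ℝ) := by
  rw [bryantPairing, wedgePairing_apply, curryLeft_psiModel, curryLeft_psiModel,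
    psiModel_eq_sumForm, altWedge_sumForm, altWedge_sumForm,
    sumForm_self (by norm_num) e _ _ _ rfl,
    sum_prod_ite_eq_zero (fun x : Fin 3 => psiCurryCoeff i x)
      (fun x : Fin 3 => psiCurryCoeff j x) psiCoeff]
  simp only [seqSign_append, psiCurryIndex_eq, (psiList_eq _).1, (psiList_eq _).2]
  congr 1
  revert i j
  decide +kernel

/-- The inner product for which the basis `e` is orthonormal. -/
def basisInner (e : Module.Basis (Fin n) ℝ W) : LinearMap.BilinForm ℝ W :=
  ∑ i, (LinearMap.mul ℝ ℝ).compl₁₂ (e.coord i) (e.coord i)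

theorem basisInner_apply (e : Module.Basis (Fin n) ℝ W) (x y : W) :
    basisInner e x y = ∑ i, e.coord i x * e.coord i y := by
  simp [basisInner, LinearMap.sum_apply]

theorem basisInner_self (e : Module.Basis (Fin n) ℝ W) (i j : Fin n) :
    basisInner e (e i) (e j) = if i = j then 1 else 0 := by
  simp [basisInner_apply, Finsupp.single_apply]

set_option maxRecDepth 10000 in
theorem bryantPairing_psiModel (e : Module.Basis (Fin 7) ℝ W) :
    bryantPairing (psiModel e) e = (-6 : ℝ) • basisInner e := by
  refine LinearMap.BilinForm.ext_basis e fun i j => ?_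
  rw [bryantPairing_psiModel_apply, LinearMap.smul_apply, LinearMap.smul_apply,
    basisInner_self]
  split_ifs <;> norm_num

/-- If `A` is the transition matrix, the Gram matrix of `b` is `Aᵀ A`. -/
theorem det_sq_eq_det_basisInner (e b : Module.Basis (Fin n) ℝ W) :
    e.det b ^ 2 = (Matrix.of fun i j => basisInner e (b i) (b j)).det := by
  rw [Module.Basis.det_apply, sq]
  nth_rw 1 [← Matrix.det_transpose]
  rw [← Matrix.det_mul]
  congr 1
  ext i j
  simp [Matrix.mul_apply, Module.Basis.toMatrix_apply, basisInner_apply]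

/-- Two frames adapted to the same `G₂`-form induce the same metric and orientation. -/
theorem basisInner_eq_and_det_eq_of_psiModel_eq (e b : Module.Basis (Fin 7) ℝ W)
    (h : psiModel e = psiModel b) : basisInner b = basisInner e ∧ b.det = e.det := by
  -- The common 3-form gives one pairing with values in 7-forms; evaluating it on `b` instead of `e`
  -- costs the factor `e.det b`, so the two metrics are proportional by that factor.
  have h1 : basisInner b = e.det b • basisInner e := by
    have h2 := bryantPairing_psiModel b
    have h3 : bryantPairing (psiModel b) b = e.det b • bryantPairing (psiModel e) e := by
      refine LinearMap.ext fun x => LinearMap.ext fun y => ?_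
      rw [← h, LinearMap.smul_apply, LinearMap.smul_apply, bryantPairing, bryantPairing,
        wedgePairing_apply, wedgePairing_apply, eq_smul_of_basis_cast _ e b, smul_eq_mul]
    rw [h3, bryantPairing_psiModel] at h2
    refine LinearMap.ext fun x => LinearMap.ext fun y => ?_
    have := LinearMap.congr_fun (LinearMap.congr_fun h2 x) y
    simp only [LinearMap.smul_apply, smul_eq_mul] at this ⊢
    linarith
  set δ := e.det b with hδ
  have h0 : δ ≠ 0 := (e.isUnit_det b).ne_zero
  -- As `b` is orthonormal for `basisInner b`, its Gram matrix for `basisInner e` is the scalar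
  -- `δ⁻¹`.
  have h4 : (Matrix.of fun i j => basisInner e (b i) (b j)) =
      δ⁻¹ • (1 : Matrix (Fin 7) (Fin 7) ℝ) := by
    ext i j
    have := basisInner_self b i j
    rw [h1, LinearMap.smul_apply, LinearMap.smul_apply, smul_eq_mul] at this
    rw [Matrix.of_apply, Matrix.smul_apply, Matrix.one_apply, ← this, smul_eq_mul,
      inv_mul_cancel_left₀ h0]
  have h5 := det_sq_eq_det_basisInner e b
  rw [h4, Matrix.det_smul, Matrix.det_one, mul_one, Fintype.card_fin, ← hδ] at h5
  -- The Gram determinant gives `δ² = δ⁻⁷`. The exponent 9 is odd, so `δ = 1` with no sign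
  -- ambiguity.
  have h6 : δ ^ 9 = 1 := by
    calc δ ^ 9 = δ ^ 2 * δ ^ 7 := by ring
      _ = 1 := by rw [h5, ← mul_pow, inv_mul_cancel₀ h0, one_pow]
  have h7 : δ = 1 := by
    have : Odd 9 := by decide
    exact this.strictMono_pow.injective (by simpa using h6)
  refine ⟨by rw [h1, h7, one_smul], ?_⟩
  rw [e.det.eq_smul_basis_det b, ← hδ, h7, one_smul]

/-- The transition matrix is orthogonal. Expanding both factors of each summand in the frame `e` and
summing over `i` contracts the matrix entries to Kronecker deltas. -/
theorem hodgeStar_eq_of_basisInner_eq (e b : Module.Basis (Fin (k + m)) ℝ W)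
    (hg : basisInner b = basisInner e) (hd : b.det = e.det) (α : W [⋀^Fin k]→ₗ[ℝ] ℝ)
    (v : Fin m → W) : hodgeStar b α v = hodgeStar e α v := by
  -- Orthonormality of the frames gives `Aᵀ A = 1`; what is needed is the reverse product `A Aᵀ =
  -- 1`.
  have hA (l r : Fin (k + m)) :
      ∑ i, e.coord l (b i) * e.coord r (b i) = if l = r then 1 else 0 := by
    have h1 : (e.toMatrix b)ᵀ * e.toMatrix b = 1 := by
      ext i j
      rw [Matrix.one_apply, ← basisInner_self b, hg, basisInner_apply]
      simp [Matrix.mul_apply, Module.Basis.toMatrix_apply]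
    have h2 : e.toMatrix b * (e.toMatrix b)ᵀ = 1 := mul_eq_one_comm.1 h1
    have h3 := congrFun (congrFun h2 l) r
    rw [Matrix.mul_apply, Matrix.one_apply] at h3
    simpa [Module.Basis.toMatrix_apply] using h3
  have hb (i : Fin (k + m)) : b i = ∑ l, e.coord l (b i) • e l := by simp [e.sum_repr]
  -- `β` is the determinant with its last `m` arguments frozen at `v`, so that it can be expanded
  -- multilinearly in the first `k`.
  let γ : MultilinearMap ℝ (fun _ : Fin k ⊕ Fin m => W) ℝ :=
    e.det.toMultilinearMap.domDomCongr finSumFinEquiv.symm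
  let β : MultilinearMap ℝ (fun _ : Fin k => W) ℝ :=
    { toFun := fun w => γ.currySum w v
      map_update_add' := fun w i x y => by
        rw [MultilinearMap.map_update_add, _root_.add_apply]
      map_update_smul' := fun w i c x => by
        rw [MultilinearMap.map_update_smul, _root_.smul_apply] }
  have hβ (w : Fin k → W) : β w = e.det (Fin.append w v) := by
    change e.det _ = _
    congr 1
    ext i
    refine Fin.addCases (fun i => ?_) (fun i => ?_) i <;> simp
  have hexp (γ : MultilinearMap ℝ (fun _ : Fin k => W) ℝ) (i : Fin k → Fin (k + m)) :
      γ (fun a => b (i a)) =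
        ∑ l : Fin k → Fin (k + m), (∏ a, e.coord (l a) (b (i a))) * γ (fun a => e (l a)) := by
    conv_lhs => rw [show (fun a => b (i a)) = fun a => ∑ l, e.coord l (b (i a)) • e l from
      funext fun a => hb (i a)]
    rw [MultilinearMap.map_sum]
    refine Finset.sum_congr rfl fun l _ => ?_
    rw [MultilinearMap.map_smul_univ, smul_eq_mul]
  rw [hodgeStar, hodgeStar, hd]
  congr 1
  simp only [← hβ]
  calc ∑ i : Fin k → Fin (k + m), α.toMultilinearMap (fun a => b (i a)) * β (fun a => b (i a))
      = ∑ i : Fin k → Fin (k + m), ∑ l : Fin k → Fin (k + m), ∑ r : Fin k → Fin (k + m),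
          (∏ a, e.coord (l a) (b (i a)) * e.coord (r a) (b (i a))) *
            (α.toMultilinearMap (fun a => e (l a)) * β (fun a => e (r a))) := by
        refine Finset.sum_congr rfl fun i _ => ?_
        rw [hexp α.toMultilinearMap, hexp β, Finset.sum_mul_sum]
        refine Finset.sum_congr rfl fun l _ => Finset.sum_congr rfl fun r _ => ?_
        rw [Finset.prod_mul_distrib]
        ring
    _ = ∑ l : Fin k → Fin (k + m), ∑ r : Fin k → Fin (k + m),
          (if l = r then 1 else 0) *
            (α.toMultilinearMap (fun a => e (l a)) * β (fun a => e (r a))) := by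
        rw [Finset.sum_comm]
        refine Finset.sum_congr rfl fun l _ => ?_
        rw [Finset.sum_comm]
        refine Finset.sum_congr rfl fun r _ => ?_
        rw [← Finset.sum_mul]
        congr 1
        rw [← Fintype.piFinset_univ]
        refine (Finset.prod_univ_sum (fun _ => Finset.univ)
          (fun a i => e.coord (l a) (b i) * e.coord (r a) (b i))).symm.trans ?_
        simp only [hA]
        rw [Finset.prod_ite_zero]
        simp [funext_iff]
    _ = ∑ l : Fin k → Fin (k + m), α (fun a => e (l a)) *
          β (fun a => e (l a)) := by
        simp only [ite_mul, one_mul, zero_mul, Finset.sum_ite_eq, Finset.mem_univ, if_true]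
        rfl

/-- Only rearrangements of `s` contribute to the sum. Each `σ` selects `i = s ∘ σ⁻¹`, and its sign
cancels the sign from reordering the determinant, so `k!` equal terms remain. -/
theorem hodgeStar_coframe (e : Module.Basis (Fin (k + m)) ℝ W) (s : Fin k → Fin (k + m))
    (v : Fin m → W) :
    hodgeStar e (coframe e s) v = e.det (Fin.append (fun a => e (s a)) v) := by
  have h (i : Fin k → Fin (k + m)) : coframe e s (fun a => e (i a)) =
      ∑ σ : Equiv.Perm (Fin k), (Equiv.Perm.sign σ : ℝ) * if s = i ∘ σ then 1 else 0 := by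
    rw [coframe_apply, Matrix.det_apply']
    refine Finset.sum_congr rfl fun σ _ => ?_
    congr 1
    simp only [Matrix.of_apply, Module.Basis.coord_apply, Module.Basis.repr_self,
      Finsupp.single_apply]
    rw [Finset.prod_ite_zero]
    simp [funext_iff, eq_comm]
  have hk : (k.factorial : ℝ) ≠ 0 := by positivity
  simp only [hodgeStar, h, Finset.sum_mul]
  rw [Finset.sum_comm]
  have h2 (σ : Equiv.Perm (Fin k)) :
      ∑ i : Fin k → Fin (k + m), (Equiv.Perm.sign σ : ℝ) * (if s = i ∘ σ then 1 else 0) *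
        e.det (Fin.append (fun a => e (i a)) v) = e.det (Fin.append (fun a => e (s a)) v) := by
    rw [Finset.sum_eq_single (s ∘ σ.symm)]
    · have h3 : Fin.append (fun a => e ((s ∘ σ.symm) a)) v =
          Fin.append (fun a => e (s a)) v ∘
            (finSumFinEquiv.permCongr (Equiv.sumCongr σ.symm (1 : Equiv.Perm (Fin m)))) := by
        ext i
        refine Fin.addCases (fun i => ?_) (fun i => ?_) i <;> simp
      have h4 : Equiv.Perm.sign (finSumFinEquiv.permCongr
          (Equiv.sumCongr σ.symm (1 : Equiv.Perm (Fin m)))) = Equiv.Perm.sign σ := by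
        rw [Equiv.Perm.sign_permCongr]
        have := Equiv.Perm.sign_sumCongr σ.symm (1 : Equiv.Perm (Fin m))
        rw [Equiv.Perm.sumCongr] at this
        simp [this]
      rw [h3, AlternatingMap.map_perm, h4, Units.smul_def, zsmul_eq_mul, ← mul_assoc,
        if_pos (by ext; simp), mul_one, ← Int.cast_mul, Int.units_coe_mul_self, Int.cast_one,
        one_mul]
    · intro i _ hi
      rw [if_neg, mul_zero, zero_mul]
      rintro rfl
      exact hi (by ext; simp)
    · simp
  simp only [h2, Finset.sum_const, Finset.card_univ, Fintype.card_perm, Fintype.card_fin,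
    nsmul_eq_mul]
  field_simp

end PointwiseG2

/-! ### Passing from six to seven dimensions -/

section PointwiseCone

variable {W : Type*} [AddCommGroup W] [Module ℝ W] {n k m : ℕ}

/-- By injectivity the matrix is block lower triangular, with the identity as its first diagonal
block. -/
theorem coframe_append_apply_append (e : Module.Basis (Fin n) ℝ W) (s : Fin k → Fin n)
    (t : Fin m → Fin n) (h : Function.Injective (Fin.append s t)) (v : Fin m → W) :
    coframe e (Fin.append s t) (Fin.append (fun a => e (s a)) v) = coframe e t v := by
  rw [coframe_apply, coframe_apply, ← Matrix.det_submatrix_equiv_self finSumFinEquiv]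
  set M := (Matrix.of fun i j => e.coord (Fin.append s t j)
    (Fin.append (fun a => e (s a)) v i)).submatrix finSumFinEquiv finSumFinEquiv with hM
  have h1 : M.toBlocks₁₁ = 1 := by
    ext i j
    have : s i = s j ↔ i = j :=
      ⟨fun hij => Fin.castAdd_injective k m (h (by simpa using hij)), fun hij => by rw [hij]⟩
    simp [hM, Matrix.toBlocks₁₁, Finsupp.single_apply, Matrix.one_apply, this]
  have h2 : M.toBlocks₁₂ = 0 := by
    ext i j
    have : s i ≠ t j := fun hij => by
      have := @h (Fin.castAdd m i) (Fin.natAdd k j) (by simpa using hij)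
      have h3 := congrArg Fin.val this
      simp at h3
      omega
    simp [hM, Matrix.toBlocks₁₂, Finsupp.single_apply, this]
  rw [← Matrix.fromBlocks_toBlocks M, h1, h2, Matrix.det_fromBlocks_zero₁₂, Matrix.det_one, one_mul]
  congr 1
  ext i j
  simp [hM, Matrix.toBlocks₂₂]

/-- The indices `s` and `t` are complementary, so `e^{st}` is the volume form up to the sign of the
sequence, and that sign squares to 1. -/
theorem hodgeStar_coframe_of_injective (e : Module.Basis (Fin (k + m)) ℝ W)
    (s : Fin k → Fin (k + m)) (t : Fin m → Fin (k + m)) (v : Fin m → W)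
    (h : Function.Injective (Fin.append s t)) :
    hodgeStar e (coframe e s) v = seqSign (Fin.append s t) * coframe e t v := by
  have h1 := (coframe e (Fin.append s t)).eq_smul_basis_det e
  rw [coframe_self] at h1
  have h2 : seqSign (Fin.append s t) * seqSign (Fin.append s t) = 1 := by
    rw [seqSign, ← Finset.prod_mul_distrib]
    refine Finset.prod_eq_one fun i _ => ?_
    rw [← Finset.prod_mul_distrib]
    refine Finset.prod_eq_one fun j hj => ?_
    have : Fin.append s t i ≠ Fin.append s t j := fun hij => (Finset.mem_Ioi.1 hj).ne (h hij)
    split_ifs <;> simp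
  rw [hodgeStar_coframe, ← coframe_append_apply_append e s t h v, h1, AlternatingMap.smul_apply,
    smul_eq_mul, ← mul_assoc, ← Int.cast_mul, h2, Int.cast_one, one_mul]

theorem hodgeStar_sumForm {κ : Type*} [Fintype κ] (e : Module.Basis (Fin (k + m)) ℝ W)
    (c : κ → ℤ) (S : κ → Fin k → Fin (k + m)) (v : Fin m → W) :
    hodgeStar e (sumForm e c S) v = ∑ a, c a * hodgeStar e (coframe e (S a)) v := by
  simp only [hodgeStar, sumForm_apply, Finset.sum_mul, Finset.mul_sum]
  rw [Finset.sum_comm]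
  refine Finset.sum_congr rfl fun a _ => Finset.sum_congr rfl fun i _ => ?_
  ring

theorem hodgeStar_psiModel (e : Module.Basis (Fin 7) ℝ W) (v : Fin 4 → W) :
    hodgeStar (k := 3) (m := 4) e (psiModel e) v =
      coframe e ![1, 2, 4, 5] v + coframe e ![0, 2, 3, 5] v + coframe e ![0, 1, 3, 4] v +
      coframe e ![3, 4, 5, 6] v - coframe e ![1, 2, 3, 6] v + coframe e ![0, 2, 4, 6] v -
      coframe e ![0, 1, 5, 6] v := by
  -- The complements of the index sets of `ψ₀`, in the same order.
  let T : Fin 7 → Fin 4 → Fin 7 := ![![1, 2, 4, 5], ![0, 2, 3, 5], ![0, 1, 3, 4], ![3, 4, 5, 6],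
    ![1, 2, 3, 6], ![0, 2, 4, 6], ![0, 1, 5, 6]]
  have hT : ∀ a, Function.Injective (Fin.append (psiIndex a) (T a)) := by
    unfold Function.Injective
    decide +kernel
  have hs : ∀ a, psiCoeff a * seqSign (n := 7) (Fin.append (psiIndex a) (T a)) =
      ![1, 1, 1, 1, -1, 1, -1] a := by
    decide +kernel
  have h : hodgeStar (k := 3) (m := 4) e (psiModel e) v =
      ∑ a, ((![1, 1, 1, 1, -1, 1, -1] a : ℤ) : ℝ) * coframe e (T a) v := by
    rw [psiModel_eq_sumForm, hodgeStar_sumForm]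
    refine Finset.sum_congr rfl fun a _ => ?_
    rw [hodgeStar_coframe_of_injective (k := 3) (m := 4) e (psiIndex a) (T a) v (hT a), ← hs a]
    push_cast
    ring
  rw [h, Fin.sum_univ_seven]
  simp [T]
  ring

variable {V : Type*} [AddCommGroup V] [Module ℝ V]

/-- The basis of `V × ℝ` obtained by adding the vector `(0, 1)` to a basis of `V`. -/
def prodBasis (e : Module.Basis (Fin 6) ℝ V) : Module.Basis (Fin 7) ℝ (V × ℝ) :=
  (e.prod (Module.Basis.singleton (Fin 1) ℝ)).reindex (finSumFinEquiv (m := 6) (n := 1))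

theorem coord_prodBasis (e : Module.Basis (Fin 6) ℝ V) (x : V × ℝ) (i : Fin 7) :
    (prodBasis e).coord i x = ![e.coord 0 x.1, e.coord 1 x.1, e.coord 2 x.1, e.coord 3 x.1,
      e.coord 4 x.1, e.coord 5 x.1, x.2] i := by
  have h (j : Fin 6) : (prodBasis e).coord (Fin.castAdd 1 j) x = e.coord j x.1 := by
    rw [prodBasis, Module.Basis.coord_apply, Module.Basis.repr_reindex_apply,
      finSumFinEquiv_symm_apply_castAdd, Module.Basis.prod_repr_inl, Module.Basis.coord_apply]
  have h' : (prodBasis e).coord (Fin.natAdd 6 (0 : Fin 1)) x = x.2 := by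
    rw [prodBasis, Module.Basis.coord_apply, Module.Basis.repr_reindex_apply,
      finSumFinEquiv_symm_apply_natAdd, Module.Basis.prod_repr_inr, Module.Basis.singleton_repr]
  fin_cases i
  exacts [h 0, h 1, h 2, h 3, h 4, h 5, h']

theorem psiModel_apply (e : Module.Basis (Fin 7) ℝ W) (v : Fin 3 → W) :
    psiModel e v = coframe e ![0, 3, 6] v + coframe e ![1, 4, 6] v + coframe e ![2, 5, 6] v +
      coframe e ![0, 1, 2] v - coframe e ![0, 4, 5] v + coframe e ![1, 3, 5] v -
      coframe e ![2, 3, 4] v := rfl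

theorem psiModel_prodBasis (e : Module.Basis (Fin 6) ℝ V) (v : Fin 3 → V × ℝ) :
    psiModel (prodBasis e) v =
      omegaModel e ![(v 0).1, (v 1).1] * (v 2).2 - omegaModel e ![(v 0).1, (v 2).1] * (v 1).2 +
        omegaModel e ![(v 1).1, (v 2).1] * (v 0).2 + phiModel e (fun i => (v i).1) := by
  simp only [psiModel_apply, omegaModel_apply, phiModel_apply, coframe_two, coframe_three,
    coord_prodBasis, Matrix.cons_val]
  ring

/-- This is `∗ψ₀ = -½ ω₀ ∧ ω₀ - φ̂₀ ∧ e⁷`, with both wedge products written out on four vectors. -/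
theorem hodgeStar_psiModel_prodBasis (e : Module.Basis (Fin 6) ℝ V) (v : Fin 4 → V × ℝ) :
    hodgeStar (k := 3) (m := 4) (prodBasis e) (psiModel (prodBasis e)) v =
      -(omegaModel e ![(v 0).1, (v 1).1] * omegaModel e ![(v 2).1, (v 3).1] -
        omegaModel e ![(v 0).1, (v 2).1] * omegaModel e ![(v 1).1, (v 3).1] +
        omegaModel e ![(v 0).1, (v 3).1] * omegaModel e ![(v 1).1, (v 2).1]) -
      (phiHatModel e ![(v 0).1, (v 1).1, (v 2).1] * (v 3).2 -
        phiHatModel e ![(v 0).1, (v 1).1, (v 3).1] * (v 2).2 +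
        phiHatModel e ![(v 0).1, (v 2).1, (v 3).1] * (v 1).2 -
        phiHatModel e ![(v 1).1, (v 2).1, (v 3).1] * (v 0).2) := by
  have h4 (a b c d : Fin 7) := coframe_apply (prodBasis e) ![a, b, c, d] v
  rw [hodgeStar_psiModel]
  simp only [h4, det_fin_four, Matrix.of_apply, omegaModel_apply, phiHatModel_apply, coframe_two,
    coframe_three, coord_prodBasis, Matrix.cons_val]
  ring

theorem basisInner_prodBasis (e : Module.Basis (Fin 6) ℝ V) (x y : V × ℝ) :
    basisInner (prodBasis e) x y = basisInner e x.1 y.1 + x.2 * y.2 := by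
  simp only [basisInner_apply, Fin.sum_univ_seven, Fin.sum_univ_six, coord_prodBasis,
    Matrix.cons_val]

theorem basisInner_rotateBasis (e : Module.Basis (Fin 6) ℝ V) {s c d : ℝ} (hs : s ≠ 0)
    (h : c ^ 2 + d ^ 2 = 1) : basisInner (rotateBasis e s c d hs h) = s ^ 2 • basisInner e := by
  refine LinearMap.ext fun x => LinearMap.ext fun y => ?_
  simp only [LinearMap.smul_apply, basisInner_apply, Fin.sum_univ_six, coord_rotateBasis,
    Matrix.cons_val, smul_eq_mul]
  linear_combination s ^ 2 * (e.coord 0 x * e.coord 0 y + e.coord 3 x * e.coord 3 y) * h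

end PointwiseCone

/-! ### Smooth families of alternating forms -/

section Smoothness

variable {F G : Type*} [NormedAddCommGroup F] [NormedSpace ℝ F] [NormedAddCommGroup G]
  [NormedSpace ℝ G] {k m : ℕ} {r : WithTop ℕ∞}

/-- Evaluation on tuples of basis vectors is an injective linear map into a finite-dimensional
space, and a linear left inverse of it is automatically continuous. -/
theorem contDiffOn_alternating_of_apply {ι : Type*} [Fintype ι] (b : Module.Basis ι ℝ G)
    {f : F → G [⋀^Fin k]→L[ℝ] ℝ} {s : Set F}
    (h : ∀ i : Fin k → ι, ContDiffOn ℝ r (fun y => f y (fun a => b (i a))) s) :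
    ContDiffOn ℝ r f s := by
  let T : (G [⋀^Fin k]→L[ℝ] ℝ) →ₗ[ℝ] ((Fin k → ι) → ℝ) :=
    { toFun := fun α i => α (fun a => b (i a))
      map_add' := fun α β => rfl
      map_smul' := fun c α => rfl }
  have hT : Function.Injective T := by
    intro α β hαβ
    apply ContinuousAlternatingMap.toAlternatingMap_injective
    refine Module.Basis.ext_alternating b fun i _ => ?_
    exact congrFun hαβ i
  obtain ⟨S, hS⟩ := T.exists_leftInverse_of_injective (LinearMap.ker_eq_bot.2 hT)
  have hf : f = fun y => LinearMap.toContinuousLinearMap S (T (f y)) := by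
    ext1 y
    exact (LinearMap.congr_fun hS (f y)).symm
  rw [hf]
  refine (LinearMap.toContinuousLinearMap S).contDiff.comp_contDiffOn ?_
  exact contDiffOn_pi.2 h

theorem contDiffOn_alternating_apply {f : F → G [⋀^Fin k]→L[ℝ] ℝ} {s : Set F}
    (h : ContDiffOn ℝ r f s) (v : Fin k → G) : ContDiffOn ℝ r (fun y => f y v) s := by
  have := (ContinuousAlternatingMap.apply ℝ G ℝ v).contDiff.comp_contDiffOn h
  exact this

theorem contDiffOn_altWedge_apply {f : F → G [⋀^Fin k]→ₗ[ℝ] ℝ} {g : F → G [⋀^Fin m]→ₗ[ℝ] ℝ}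
    {s : Set F} (hf : ∀ v, ContDiffOn ℝ r (fun y => f y v) s)
    (hg : ∀ v, ContDiffOn ℝ r (fun y => g y v) s) (v : Fin (k + m) → G) :
    ContDiffOn ℝ r (fun y => altWedge (f y) (g y) v) s := by
  simp only [altWedge_apply, Units.smul_def, zsmul_eq_mul]
  refine contDiffOn_const.mul (ContDiffOn.sum fun σ _ => contDiffOn_const.mul ?_)
  exact (hf _).mul (hg _)

theorem contDiffOn_cube_apply {f : F → G [⋀^Fin 2]→ₗ[ℝ] ℝ} {s : Set F}
    (hf : ∀ v, ContDiffOn ℝ r (fun y => f y v) s) (v : Fin (2 + (2 + 2)) → G) :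
    ContDiffOn ℝ r (fun y => cube (f y) v) s :=
  contDiffOn_altWedge_apply hf (contDiffOn_altWedge_apply hf hf) v

theorem contDiffOn_hitchinForm_apply {f : F → G [⋀^Fin 3]→ₗ[ℝ] ℝ} {s : Set F}
    (hf : ∀ v, ContDiffOn ℝ r (fun y => f y v) s) (x y z : G) (v : Fin (1 + (2 + 3)) → G) :
    ContDiffOn ℝ r (fun p => hitchinForm (f p) (evalTail (f p) y z) x v) s :=
  contDiffOn_altWedge_apply (k := 1) (m := 2 + 3) (fun v => hf ![v 0, y, z])
    (contDiffOn_altWedge_apply (k := 2) (m := 3) (fun v => hf (Matrix.vecCons x v)) hf) v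

/-- The frame `e` may vary arbitrarily with `y`. Smoothness comes from `cube_mul_phiHatModel` on a
fixed basis `b`, where `φ̂` is a quotient of smooth functions with denominator `ω³(b) ≠ 0`. -/
theorem contDiffOn_phiHatModel_apply (b : Module.Basis (Fin 6) ℝ G) {s : Set F}
    {A : F → G [⋀^Fin 2]→ₗ[ℝ] ℝ} {B C : F → G [⋀^Fin 3]→ₗ[ℝ] ℝ}
    (hA : ∀ v, ContDiffOn ℝ r (fun y => A y v) s) (hC : ∀ v, ContDiffOn ℝ r (fun y => C y v) s)
    (h : ∀ y ∈ s, ∃ e : Module.Basis (Fin 6) ℝ G,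
      A y = omegaModel e ∧ C y = phiModel e ∧ B y = phiHatModel e) (x₀ x₁ x₂ : G) :
    ContDiffOn ℝ r (fun y => B y ![x₀, x₁, x₂]) s := by
  obtain ⟨p, hp⟩ : ∃ p : F → ℝ, ∀ y, p y = cube (A y) b := ⟨_, fun _ => rfl⟩
  obtain ⟨q, hq⟩ : ∃ q : F → ℝ, ∀ y, q y = hitchinForm (C y) (evalTail (C y) x₁ x₂) x₀ b :=
    ⟨_, fun _ => rfl⟩
  have hp' : ContDiffOn ℝ r p s := by
    rw [show p = _ from funext hp]
    exact contDiffOn_cube_apply hA _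
  have hq' : ContDiffOn ℝ r q s := by
    rw [show q = _ from funext hq]
    exact contDiffOn_hitchinForm_apply hC x₀ x₁ x₂ _
  have h0 : ∀ y ∈ s, p y ≠ 0 := by
    intro y hy
    obtain ⟨e, he, -, -⟩ := h y hy
    rw [hp, he, cube_apply_eq_det_mul _ e b, cube_omegaModel_self]
    exact mul_ne_zero (e.isUnit_det b).ne_zero (by norm_num)
  refine (((contDiffOn_const (c := (3 : ℝ))).mul hq').div hp' h0).congr fun y hy => ?_
  obtain ⟨e, he1, he2, he3⟩ := h y hy
  have hmul := cube_mul_phiHatModel e b x₀ x₁ x₂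
  rw [← he1, ← he2, ← he3, ← hp, ← hq] at hmul
  change _ = 3 * q y / p y
  rw [eq_div_iff (h0 y hy), mul_comm]
  exact hmul

end Smoothness

/-! ### Model forms under linear isomorphisms -/

section Transport

variable {V W : Type*} [AddCommGroup V] [Module ℝ V] [AddCommGroup W] [Module ℝ W]

theorem omegaModel_map (e : Module.Basis (Fin 6) ℝ V) (f : V ≃ₗ[ℝ] W) (v : Fin 2 → W) :
    omegaModel (e.map f) v = omegaModel e (fun i => f.symm (v i)) := rfl

theorem phiModel_map (e : Module.Basis (Fin 6) ℝ V) (f : V ≃ₗ[ℝ] W) (v : Fin 3 → W) :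
    phiModel (e.map f) v = phiModel e (fun i => f.symm (v i)) := rfl

theorem phiHatModel_map (e : Module.Basis (Fin 6) ℝ V) (f : V ≃ₗ[ℝ] W) (v : Fin 3 → W) :
    phiHatModel (e.map f) v = phiHatModel e (fun i => f.symm (v i)) := rfl

end Transport

/-! ### `φ̂` and the metric on the manifold -/

section SU3Forms

variable {M : Type*} [TopologicalSpace M] [ChartedSpace (EuclideanSpace ℝ (Fin 6)) M]
  {o : TangentOrientation M} {ω : DiffForm (𝓡 6) M 2} {φ : DiffForm (𝓡 6) M 3} {x : M}
  {e : Module.Basis (Fin 6) ℝ (TangentSpace (𝓡 6) x)}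

theorem almostComplex_apply (ho : e.orientation = o x)
    (hφ : (φ x).toAlternatingMap = phiModel e) (v : TangentSpace (𝓡 6) x) :
    almostComplex o φ x v = complexStr e (phiModel e) v := by
  have h : 0 < e.det ((o x).someBasis (card_eq_finrank_tangentSpace x)) := by
    rw [← Module.Basis.orientation_eq_iff_det_pos, ho, Orientation.someBasis_orientation]
  rw [almostComplex, LinearMap.coe_toContinuousLinearMap', complexStr_basis e _ _ h, hφ]

theorem hat_eq_phiHatModel (ho : e.orientation = o x)
    (hφ : (φ x).toAlternatingMap = phiModel e) :
    (hat o φ x).toAlternatingMap = phiHatModel e := by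
  ext v
  rw [← phiModel_complexStr, ← hφ]
  change φ x (fun i => almostComplex o φ x (v i)) = φ x _
  congr 1
  ext1 i
  rw [almostComplex_apply ho hφ, hφ]

theorem su3Metric_eq_basisInner (ho : e.orientation = o x)
    (hω : (ω x).toAlternatingMap = omegaModel e) (hφ : (φ x).toAlternatingMap = phiModel e) :
    su3Metric o ω φ x = basisInner e := by
  refine LinearMap.ext fun X => LinearMap.ext fun Y => ?_
  rw [basisInner_apply, ← omegaModel_complexStr, ← hω, ← almostComplex_apply ho hφ]
  rfl

variable [IsManifold (𝓡 6) ((⊤ : ℕ∞) : WithTop ℕ∞) M]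

/-- The derivative of the inverse chart is invertible, so an adapted frame of the tangent space
pulls back to the model space. `φ̂` is identified with its model before the transport, while the
orientation is still at hand. -/
theorem IsSU3Structure.exists_frame_chartForm (h : IsSU3Structure o ω φ) (x₀ : M)
    {y : EuclideanSpace ℝ (Fin 6)} (hy : y ∈ (extChartAt (𝓡 6) x₀).target) :
    ∃ e : Module.Basis (Fin 6) ℝ (EuclideanSpace ℝ (Fin 6)),
      (chartForm (𝓡 6) ω x₀ y).toAlternatingMap = omegaModel e ∧
      (chartForm (𝓡 6) φ x₀ y).toAlternatingMap = phiModel e ∧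
      (chartForm (𝓡 6) (hat o φ) x₀ y).toAlternatingMap = phiHatModel e := by
  have : IsManifold (𝓡 6) 1 M := .of_le (n := ((⊤ : ℕ∞) : WithTop ℕ∞)) (by simp)
  obtain ⟨e, ho, hω, hφ⟩ := h.exists_frame ((extChartAt (𝓡 6) x₀).symm y)
  have hh := hat_eq_phiHatModel ho hφ
  obtain ⟨L, hL⟩ := isInvertible_mfderivWithin_extChartAt_symm hy
  let L' : EuclideanSpace ℝ (Fin 6) ≃ₗ[ℝ]
      TangentSpace (𝓡 6) ((extChartAt (𝓡 6) x₀).symm y) := L.toLinearEquiv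
  have hL' (v : EuclideanSpace ℝ (Fin 6)) :
      mfderivWithin 𝓘(ℝ, EuclideanSpace ℝ (Fin 6)) (𝓡 6) (extChartAt (𝓡 6) x₀).symm
        (Set.range (𝓡 6)) y v = L' v := by
    rw [← hL]
    rfl
  refine ⟨e.map L'.symm, ?_, ?_, ?_⟩
  · refine AlternatingMap.ext fun v => Eq.trans ?_ (omegaModel_map e L'.symm v).symm
    rw [← hω]
    exact congrArg (ω _) (funext fun i => hL' (v i))
  · refine AlternatingMap.ext fun v => Eq.trans ?_ (phiModel_map e L'.symm v).symm
    rw [← hφ]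
    exact congrArg (φ _) (funext fun i => hL' (v i))
  · refine AlternatingMap.ext fun v => Eq.trans ?_ (phiHatModel_map e L'.symm v).symm
    rw [← hh]
    exact congrArg (hat o φ _) (funext fun i => hL' (v i))

theorem IsSU3Structure.smooth_hat (h : IsSU3Structure o ω φ) :
    IsSmoothForm (𝓡 6) (hat o φ) := by
  intro x₀
  let b : Module.Basis (Fin 6) ℝ (EuclideanSpace ℝ (Fin 6)) :=
    (EuclideanSpace.basisFun (Fin 6) ℝ).toBasis
  have hω (v) := contDiffOn_alternating_apply (h.smooth_omega x₀) v
  have hφ (v) := contDiffOn_alternating_apply (h.smooth_phi x₀) v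
  refine contDiffOn_alternating_of_apply b fun i => ?_
  have hv : (fun a => b (i a)) = ![b (i 0), b (i 1), b (i 2)] := by
    ext1 a
    fin_cases a <;> rfl
  rw [hv]
  exact contDiffOn_phiHatModel_apply b (A := fun y => (chartForm (𝓡 6) ω x₀ y).toAlternatingMap)
    (B := fun y => (chartForm (𝓡 6) (hat o φ) x₀ y).toAlternatingMap)
    (C := fun y => (chartForm (𝓡 6) φ x₀ y).toAlternatingMap) hω hφ
    (fun y hy => h.exists_frame_chartForm x₀ hy) _ _ _

end SU3Forms

/-! ### Forms and their exterior derivative in the chart at a point -/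

section ExteriorDerivative

open scoped Topology

variable {E : Type*} [NormedAddCommGroup E] [NormedSpace ℝ E]
  {H : Type*} [TopologicalSpace H] {I : ModelWithCorners ℝ E H}
  {M : Type*} [TopologicalSpace M] [ChartedSpace H M] {k : ℕ}

variable (I) in
/-- The derivative of the inverse of the chart at `x₀`. -/
def chartSymmDeriv (x₀ : M) (y : E) : E →L[ℝ] E :=
  mfderivWithin 𝓘(ℝ, E) I (extChartAt I x₀).symm (Set.range I) y

theorem chartForm_apply (η : DiffForm I M k) (x₀ : M) (y : E) (v : Fin k → E) :
    chartForm I η x₀ y v =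
      (show E [⋀^Fin k]→L[ℝ] ℝ from η ((extChartAt I x₀).symm y))
        (fun i => chartSymmDeriv I x₀ y (v i)) := rfl

theorem IsSmoothForm.contDiffAt [I.Boundaryless] {η : DiffForm I M k} (h : IsSmoothForm I η) {x : M} {y : E}
    (hy : y ∈ (extChartAt I x).target) :
    ContDiffAt ℝ ((⊤ : ℕ∞) : WithTop ℕ∞) (chartForm I η x) y :=
  (h x).contDiffAt ((isOpen_extChartAt_target x).mem_nhds hy)

variable [IsManifold I 1 M]

theorem chartSymmDeriv_self (x : M) :
    chartSymmDeriv I x (extChartAt I x x) = ContinuousLinearMap.id ℝ E :=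
  mfderivWithin_range_extChartAt_symm

theorem chartForm_self (η : DiffForm I M k) (x : M) (v : Fin k → E) :
    chartForm I η x (extChartAt I x x) v = (show E [⋀^Fin k]→L[ℝ] ℝ from η x) v := by
  rw [chartForm_apply, chartSymmDeriv_self]
  have h (z : M) (hz : z = x) : (show E [⋀^Fin k]→L[ℝ] ℝ from η z) v =
      (show E [⋀^Fin k]→L[ℝ] ℝ from η x) v := by rw [hz]
  exact h _ (extChartAt_to_inv x)

variable [I.Boundaryless]

theorem extD_apply (η : DiffForm I M k) (x : M) (v : Fin (k + 1) → E) :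
    (show E [⋀^Fin (k + 1)]→L[ℝ] ℝ from extD I η x) v =
      extDeriv (chartForm I η x) (extChartAt I x x) v := by
  have h1 : (show E →L[ℝ] E from mfderiv I 𝓘(ℝ, E) (extChartAt I x) x) =
      ContinuousLinearMap.id ℝ E := mfderiv_extChartAt_self
  have h2 : (show E [⋀^Fin (k + 1)]→L[ℝ] ℝ from extD I η x) v =
      extDerivWithin (chartForm I η x) (Set.range I) (extChartAt I x x)
        (fun i => (show E →L[ℝ] E from mfderiv I 𝓘(ℝ, E) (extChartAt I x) x) (v i)) := rfl
  rw [h2, h1, I.range_eq_univ, extDerivWithin_univ]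
  rfl

theorem hasMFDerivAt_extChartAt_symm {x : M} {y : E} (hy : y ∈ (extChartAt I x).target) :
    HasMFDerivAt 𝓘(ℝ, E) I (extChartAt I x).symm y (chartSymmDeriv (E := E) I x y) := by
  have h := (mdifferentiableWithinAt_extChartAt_symm (I := I) hy).hasMFDerivWithinAt
  have aux : ∀ L, HasMFDerivWithinAt 𝓘(ℝ, E) I (extChartAt I x).symm (Set.range I) y L →
      HasMFDerivAt 𝓘(ℝ, E) I (extChartAt I x).symm y L := fun L hL => by
    rwa [I.range_eq_univ, hasMFDerivWithinAt_univ] at hL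
  exact aux _ h

theorem fderiv_extChartAt_comp_symm {x z : M} {y : E} (hy : y ∈ (extChartAt I x).target)
    (hz : (extChartAt I x).symm y ∈ (extChartAt I z).source) :
    fderiv ℝ (extChartAt I z ∘ (extChartAt I x).symm) y =
      (show E →L[ℝ] E from mfderiv I 𝓘(ℝ, E) (extChartAt I z) ((extChartAt I x).symm y)) ∘L
        chartSymmDeriv I x y := by
  have h1 := (mdifferentiableAt_extChartAt (I := I) (x := z)
    (by rwa [extChartAt_source] at hz)).hasMFDerivAt
  have h2 : HasFDerivAt (extChartAt I z ∘ (extChartAt I x).symm)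
      ((show E →L[ℝ] E from mfderiv I 𝓘(ℝ, E) (extChartAt I z) ((extChartAt I x).symm y)) ∘L
        chartSymmDeriv I x y) y :=
    hasMFDerivAt_iff_hasFDerivAt.1 (h1.comp y (hasMFDerivAt_extChartAt_symm hy))
  exact h2.fderiv

end ExteriorDerivative

/-! ### Independence of the exterior derivative from the chart -/

section ExteriorDerivativeInCharts

open scoped Topology

variable {E : Type*} [NormedAddCommGroup E] [NormedSpace ℝ E]
  {H : Type*} [TopologicalSpace H] {I : ModelWithCorners ℝ E H} [I.Boundaryless]
  {M : Type*} [TopologicalSpace M] [ChartedSpace H M]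
  [IsManifold I ((⊤ : ℕ∞) : WithTop ℕ∞) M] {k : ℕ}

/-- By the chain rule, expressions in two charts differ by pull-back along the transition map; this
holds only where both charts are defined, hence near `y`. -/
theorem chartForm_eventuallyEq_pullback (η : DiffForm I M k) (x : M) {y : E} (hy : y ∈ (extChartAt I x).target) :
    chartForm I η x =ᶠ[𝓝 y] fun y' =>
      (chartForm I η ((extChartAt I x).symm y)
        ((extChartAt I ((extChartAt I x).symm y) ∘ (extChartAt I x).symm) y')).compContinuousLinearMap
      (fderiv ℝ (extChartAt I ((extChartAt I x).symm y) ∘ (extChartAt I x).symm) y') := by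
  have : IsManifold I 1 M := .of_le (n := ((⊤ : ℕ∞) : WithTop ℕ∞)) (by simp)
  have hc : ContinuousAt (extChartAt I x).symm y :=
    (continuousOn_extChartAt_symm x).continuousAt ((isOpen_extChartAt_target x).mem_nhds hy)
  filter_upwards [(isOpen_extChartAt_target x).mem_nhds hy,
    hc.preimage_mem_nhds (extChartAt_source_mem_nhds (I := I) ((extChartAt I x).symm y))]
    with y' hy' hz
  set z := (extChartAt I x).symm y
  have hw : (extChartAt I z).symm (extChartAt I z ((extChartAt I x).symm y')) =
      (extChartAt I x).symm y' := (extChartAt I z).left_inv hz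
  refine ContinuousAlternatingMap.ext fun v => ?_
  rw [fderiv_extChartAt_comp_symm hy' hz]
  have key (i : Fin k) : chartSymmDeriv I z (extChartAt I z ((extChartAt I x).symm y'))
      ((show E →L[ℝ] E from mfderiv I 𝓘(ℝ, E) (extChartAt I z) ((extChartAt I x).symm y'))
        (chartSymmDeriv I x y' (v i))) = chartSymmDeriv I x y' (v i) :=
    congrArg (fun L : E →L[ℝ] E => L (chartSymmDeriv I x y' (v i)))
      (mfderivWithin_extChartAt_symm_comp_mfderiv_extChartAt' hz)
  rw [chartForm_apply]
  refine Eq.trans ?_ (chartForm_apply η z _ _).symm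
  have h (w : M) (hw : w = (extChartAt I x).symm y') (u : Fin k → E) :
      (show E [⋀^Fin k]→L[ℝ] ℝ from η w) u =
      (show E [⋀^Fin k]→L[ℝ] ℝ from η ((extChartAt I x).symm y')) u := by rw [hw]
  refine Eq.trans ?_ (h _ hw _).symm
  exact congrArg _ (funext fun i => (key i).symm)

/-- The exterior derivative can be computed in any chart. -/
theorem chartForm_extD {η : DiffForm I M k} (h : IsSmoothForm I η) (x : M) {y : E}
    (hy : y ∈ (extChartAt I x).target) :
    chartForm I (extD I η) x y = extDeriv (chartForm I η x) y := by
  have : IsManifold I 1 M := .of_le (n := ((⊤ : ℕ∞) : WithTop ℕ∞)) (by simp)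
  set z := (extChartAt I x).symm y with hz
  set τ : E → E := extChartAt I z ∘ (extChartAt I x).symm with hτ
  have hzx : z ∈ (extChartAt I x).source := (extChartAt I x).map_target hy
  have hτy : τ y = extChartAt I z z := by simp [hτ, hz]
  have hτs : ContDiffAt ℝ ((⊤ : ℕ∞) : WithTop ℕ∞) τ y := by
    have := contDiffWithinAt_ext_coord_change (I := I) (n := ((⊤ : ℕ∞) : WithTop ℕ∞)) z x (y := y)
      ⟨hy, mem_extChartAt_source z⟩
    rwa [I.range_eq_univ, contDiffWithinAt_univ] at this
  -- The chart at `z` has identity derivative at `z`, so the transition map and the inverse chart at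
  -- `x` have the same derivative at `y`.
  have hτd : fderiv ℝ τ y = chartSymmDeriv I x y := by
    rw [hτ, fderiv_extChartAt_comp_symm hy (mem_extChartAt_source z)]
    have h1 : (show E →L[ℝ] E from mfderiv I 𝓘(ℝ, E) (extChartAt I z) z) =
      ContinuousLinearMap.id ℝ E := mfderiv_extChartAt_self
    exact congrArg (fun L : E →L[ℝ] E => L ∘L chartSymmDeriv I x y) h1
  have h1 := (chartForm_eventuallyEq_pullback η x hy).extDeriv_eq
  rw [h1]
  -- The flat exterior derivative commutes with pull-back by the transition map, and at `z` the
  -- derivative `extD` is by definition the one in the chart at `z`.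
  refine (ContinuousAlternatingMap.ext fun v => ?_).trans
    (extDeriv_pullback (ω := chartForm I η z) (f := τ) (r := ((⊤ : ℕ∞) : WithTop ℕ∞)) ?_ hτs
      (by simpa using WithTop.coe_le_coe.2 (le_top : (2 : ℕ∞) ≤ ⊤))).symm
  · rw [chartForm_apply, hτd, hτy]
    exact extD_apply η z _
  · rw [hτy]
    exact (h.contDiffAt (mem_extChartAt_target z)).differentiableAt (by simp)

end ExteriorDerivativeInCharts

/-! ### Charts of `M × (0, π)` and the lifted form in them -/

section ConeCharts

open scoped Topology

theorem coe_extChartAt_symm {t : coneInterval} {s : ℝ}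
    (hs : s ∈ (extChartAt 𝓘(ℝ, ℝ) t).target) : ((extChartAt 𝓘(ℝ, ℝ) t).symm s : ℝ) = s := by
  have h : (extChartAt 𝓘(ℝ, ℝ) t) ((extChartAt 𝓘(ℝ, ℝ) t).symm s) = s :=
    (extChartAt 𝓘(ℝ, ℝ) t).right_inv hs
  exact h

theorem hasMFDerivAt_coe_coneInterval (t : coneInterval) :
    HasMFDerivAt 𝓘(ℝ, ℝ) 𝓘(ℝ, ℝ) ((↑) : coneInterval → ℝ) t (ContinuousLinearMap.id ℝ ℝ) := by
  refine ⟨continuous_subtype_val.continuousAt, ?_⟩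
  refine HasFDerivAt.hasFDerivWithinAt ?_
  refine (hasFDerivAt_id _).congr_of_eventuallyEq ?_
  filter_upwards [extChartAt_target_mem_nhds (I := 𝓘(ℝ, ℝ)) t] with s hs
  exact coe_extChartAt_symm hs

variable {M : Type*} [TopologicalSpace M] [ChartedSpace (EuclideanSpace ℝ (Fin 6)) M]

local notation "F₆" => EuclideanSpace ℝ (Fin 6)

theorem hasMFDerivAt_coe_snd (p : M × coneInterval) :
    HasMFDerivAt coneModel 𝓘(ℝ, ℝ) (fun q : M × coneInterval => (q.2 : ℝ)) p
      (ContinuousLinearMap.snd ℝ F₆ ℝ) :=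
  (hasMFDerivAt_coe_coneInterval p.2).comp p (hasMFDerivAt_snd p)

theorem mfderiv_fst_cone_apply (p : M × coneInterval) (u : F₆ × ℝ) :
    (show F₆ × ℝ →L[ℝ] F₆ from mfderiv coneModel (𝓡 6) Prod.fst p) u = u.1 :=
  congrArg (fun L : F₆ × ℝ →L[ℝ] F₆ => L u) (mfderiv_fst (x := p))

theorem mfderiv_coe_snd_apply (p : M × coneInterval) (u : F₆ × ℝ) :
    (show F₆ × ℝ →L[ℝ] ℝ from
      mfderiv coneModel 𝓘(ℝ, ℝ) (fun q : M × coneInterval => (q.2 : ℝ)) p) u = u.2 :=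
  congrArg (fun L : F₆ × ℝ →L[ℝ] ℝ => L u) (hasMFDerivAt_coe_snd p).mfderiv

theorem liftForm_apply (ω : ℝ → DiffForm (𝓡 6) M 2) (φ : ℝ → DiffForm (𝓡 6) M 3)
    (p : M × coneInterval) (w : Fin 3 → F₆ × ℝ) :
    (show (F₆ × ℝ) [⋀^Fin 3]→L[ℝ] ℝ from liftForm ω φ p) w =
      (show F₆ [⋀^Fin 2]→L[ℝ] ℝ from ω p.2 p.1) ![(w 0).1, (w 1).1] * (w 2).2 -
      (show F₆ [⋀^Fin 2]→L[ℝ] ℝ from ω p.2 p.1) ![(w 0).1, (w 2).1] * (w 1).2 +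
      (show F₆ [⋀^Fin 2]→L[ℝ] ℝ from ω p.2 p.1) ![(w 1).1, (w 2).1] * (w 0).2 +
      (show F₆ [⋀^Fin 3]→L[ℝ] ℝ from φ p.2 p.1) (fun i => (w i).1) := by
  have h1 := mfderiv_fst_cone_apply p
  have h2 := mfderiv_coe_snd_apply p
  have h3 : (show (F₆ × ℝ) [⋀^Fin 3]→L[ℝ] ℝ from
      pullback (𝓡 6) coneModel Prod.fst (φ p.2) p) w =
      (show F₆ [⋀^Fin 3]→L[ℝ] ℝ from φ p.2 p.1) (fun i => (w i).1) :=
    congrArg (show F₆ [⋀^Fin 3]→L[ℝ] ℝ from φ p.2 p.1) (funext fun i => h1 (w i))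
  have h4 (u v : F₆ × ℝ) : (show (F₆ × ℝ) [⋀^Fin 2]→L[ℝ] ℝ from
      pullback (𝓡 6) coneModel Prod.fst (ω p.2) p) ![u, v] =
      (show F₆ [⋀^Fin 2]→L[ℝ] ℝ from ω p.2 p.1) ![u.1, v.1] := by
    refine congrArg (show F₆ [⋀^Fin 2]→L[ℝ] ℝ from ω p.2 p.1) (funext fun i => ?_)
    fin_cases i
    · exact h1 u
    · exact h1 v
  have h5 (u : F₆ × ℝ) : (show (F₆ × ℝ) [⋀^Fin 1]→L[ℝ] ℝ from dt M p) ![u] = u.2 := h2 u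
  rw [← h3]
  refine congrArg (fun r : ℝ => r + _) ?_
  refine (altWedge_two_one (show (F₆ × ℝ) [⋀^Fin 2]→L[ℝ] ℝ from
      pullback (𝓡 6) coneModel Prod.fst (ω p.2) p).toAlternatingMap
    (show (F₆ × ℝ) [⋀^Fin 1]→L[ℝ] ℝ from dt M p).toAlternatingMap w).trans ?_
  simp only [← h4, ← h5]
  rfl

theorem extChartAt_cone_symm_apply (p : M × coneInterval) (q : F₆ × ℝ) :
    (extChartAt coneModel p).symm q =
      ((extChartAt (𝓡 6) p.1).symm q.1, (extChartAt 𝓘(ℝ, ℝ) p.2).symm q.2) := by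
  rw [extChartAt_prod]
  rfl

theorem mem_extChartAt_cone_target {p : M × coneInterval} {q : F₆ × ℝ} :
    q ∈ (extChartAt coneModel p).target ↔
      q.1 ∈ (extChartAt (𝓡 6) p.1).target ∧ q.2 ∈ (extChartAt 𝓘(ℝ, ℝ) p.2).target := by
  rw [extChartAt_prod]
  rfl

theorem extChartAt_cone_apply_self (p : M × coneInterval) :
    extChartAt coneModel p p = (extChartAt (𝓡 6) p.1 p.1, (p.2 : ℝ)) := by
  rw [extChartAt_prod]
  rfl

variable [IsManifold (𝓡 6) ((⊤ : ℕ∞) : WithTop ℕ∞) M]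

/-- Each component is found by composing with a projection and using uniqueness of the derivative.
For the second, the interval is included in `ℝ`, where the inverse chart becomes the identity near
`q.2`. -/
theorem chartSymmDeriv_cone {p : M × coneInterval} {q : F₆ × ℝ}
    (hq : q ∈ (extChartAt coneModel p).target) (v : F₆ × ℝ) :
    chartSymmDeriv coneModel p q v = (chartSymmDeriv (𝓡 6) p.1 q.1 v.1, v.2) := by
  have : IsManifold (𝓡 6) 1 M := .of_le (n := ((⊤ : ℕ∞) : WithTop ℕ∞)) (by simp)
  have hq' := mem_extChartAt_cone_target.1 hq
  have h := hasMFDerivAt_extChartAt_symm hq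
  have e1 : Prod.fst ∘ (extChartAt coneModel p).symm = (extChartAt (𝓡 6) p.1).symm ∘ Prod.fst :=
    funext fun q' => congrArg Prod.fst (extChartAt_cone_symm_apply p q')
  have h1 := (hasMFDerivAt_fst _).comp q h
  have h1' := (hasMFDerivAt_extChartAt_symm hq'.1).comp q
    (hasFDerivAt_fst (𝕜 := ℝ) (E := F₆) (F := ℝ) (p := q)).hasMFDerivAt
  rw [e1] at h1
  have h2 := (hasMFDerivAt_coe_snd _).comp q h
  have e2 : (fun q : M × coneInterval => (q.2 : ℝ)) ∘ (extChartAt coneModel p).symm =ᶠ[𝓝 q]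
      Prod.snd := by
    filter_upwards [(isOpen_extChartAt_target p).mem_nhds hq] with q' hq'
    rw [Function.comp_apply, extChartAt_cone_symm_apply]
    exact coe_extChartAt_symm (mem_extChartAt_cone_target.1 hq').2
  have h2' := (hasFDerivAt_snd (𝕜 := ℝ) (E := F₆) (F := ℝ) (p := q)).hasMFDerivAt.congr_of_eventuallyEq e2
  refine Prod.ext ?_ ?_
  · exact congrArg (fun L : F₆ × ℝ →L[ℝ] F₆ => L v) (hasMFDerivAt_unique h1 h1')
  · exact congrArg (fun L : F₆ × ℝ →L[ℝ] ℝ => L v) (hasMFDerivAt_unique h2 h2')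

theorem chartForm_liftForm (ω : ℝ → DiffForm (𝓡 6) M 2) (φ : ℝ → DiffForm (𝓡 6) M 3)
    {p : M × coneInterval} {q : F₆ × ℝ} (hq : q ∈ (extChartAt coneModel p).target)
    (w : Fin 3 → F₆ × ℝ) :
    chartForm coneModel (liftForm ω φ) p q w =
      chartForm (𝓡 6) (ω q.2) p.1 q.1 ![(w 0).1, (w 1).1] * (w 2).2 -
      chartForm (𝓡 6) (ω q.2) p.1 q.1 ![(w 0).1, (w 2).1] * (w 1).2 +
      chartForm (𝓡 6) (ω q.2) p.1 q.1 ![(w 1).1, (w 2).1] * (w 0).2 +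
      chartForm (𝓡 6) (φ q.2) p.1 q.1 (fun i => (w i).1) := by
  rw [chartForm_apply, liftForm_apply]
  have hs : (((extChartAt coneModel p).symm q).2 : ℝ) = q.2 := by
    rw [extChartAt_cone_symm_apply]
    exact coe_extChartAt_symm (mem_extChartAt_cone_target.1 hq).2
  have hy : ((extChartAt coneModel p).symm q).1 = (extChartAt (𝓡 6) p.1).symm q.1 := by
    rw [extChartAt_cone_symm_apply]
  simp only [chartSymmDeriv_cone hq]
  have key {k : ℕ} (η : ℝ → DiffForm (𝓡 6) M k) (u : Fin k → F₆) :
      (show F₆ [⋀^Fin k]→L[ℝ] ℝ from η ((extChartAt coneModel p).symm q).2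
        ((extChartAt coneModel p).symm q).1) (fun i => chartSymmDeriv (𝓡 6) p.1 q.1 (u i)) =
      chartForm (𝓡 6) (η q.2) p.1 q.1 u := by
    rw [chartForm_apply, hs, hy]
  have h2 (u v : F₆) :
      (show F₆ [⋀^Fin 2]→L[ℝ] ℝ from ω ((extChartAt coneModel p).symm q).2
        ((extChartAt coneModel p).symm q).1)
        ![chartSymmDeriv (𝓡 6) p.1 q.1 u, chartSymmDeriv (𝓡 6) p.1 q.1 v] =
      chartForm (𝓡 6) (ω q.2) p.1 q.1 ![u, v] := by
    rw [← key]
    congr 1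
    ext1 i
    fin_cases i <;> rfl
  rw [h2, h2, h2, key φ (fun i => (w i).1)]

end ConeCharts

/-! ### The exterior derivative of a form on a product with an interval -/

section ConeDerivative

open scoped Topology

variable {F : Type*} [NormedAddCommGroup F] [NormedSpace ℝ F] {k : ℕ}

theorem hasFDerivAt_alternating_apply {G : Type*} [NormedAddCommGroup G] [NormedSpace ℝ G]
    {f : G → F [⋀^Fin k]→L[ℝ] ℝ} {f' : G →L[ℝ] F [⋀^Fin k]→L[ℝ] ℝ} {y : G}
    (h : HasFDerivAt f f' y) (w : Fin k → F) :
    HasFDerivAt (fun z => f z w) ((ContinuousAlternatingMap.apply ℝ F ℝ w) ∘L f') y :=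
  (ContinuousAlternatingMap.apply ℝ F ℝ w).hasFDerivAt.comp y h

theorem fderiv_alternating_apply {G : Type*} [NormedAddCommGroup G] [NormedSpace ℝ G]
    {f : G → F [⋀^Fin k]→L[ℝ] ℝ} {y : G} (h : DifferentiableAt ℝ f y) (w : Fin k → F) (u : G) :
    fderiv ℝ (fun z => f z w) y u = fderiv ℝ f y u w := by
  rw [(hasFDerivAt_alternating_apply h.hasFDerivAt w).fderiv]
  rfl

theorem extDeriv_two_apply {A : F → F [⋀^Fin 2]→L[ℝ] ℝ} {y : F} (h : DifferentiableAt ℝ A y)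
    (a b c : F) :
    extDeriv A y ![a, b, c] = fderiv ℝ A y a ![b, c] - fderiv ℝ A y b ![a, c] +
      fderiv ℝ A y c ![a, b] := by
  rw [extDeriv_apply h, Fin.sum_univ_three]
  have h0 : (0 : Fin 3).removeNth ![a, b, c] = ![b, c] := by ext i; fin_cases i <;> rfl
  have h1 : (1 : Fin 3).removeNth ![a, b, c] = ![a, c] := by ext i; fin_cases i <;> rfl
  have h2 : (2 : Fin 3).removeNth ![a, b, c] = ![a, b] := by ext i; fin_cases i <;> rfl
  rw [h0, h1, h2]
  simp only [fderiv_alternating_apply h]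
  simp
  ring

theorem extDeriv_three_apply {B : F → F [⋀^Fin 3]→L[ℝ] ℝ} {y : F} (h : DifferentiableAt ℝ B y)
    (v : Fin 4 → F) :
    extDeriv B y v = fderiv ℝ B y (v 0) ![v 1, v 2, v 3] - fderiv ℝ B y (v 1) ![v 0, v 2, v 3] +
      fderiv ℝ B y (v 2) ![v 0, v 1, v 3] - fderiv ℝ B y (v 3) ![v 0, v 1, v 2] := by
  rw [extDeriv_apply h, Fin.sum_univ_four]
  have h0 : (0 : Fin 4).removeNth v = ![v 1, v 2, v 3] := by ext i; fin_cases i <;> rfl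
  have h1 : (1 : Fin 4).removeNth v = ![v 0, v 2, v 3] := by ext i; fin_cases i <;> rfl
  have h2 : (2 : Fin 4).removeNth v = ![v 0, v 1, v 3] := by ext i; fin_cases i <;> rfl
  have h3 : (3 : Fin 4).removeNth v = ![v 0, v 1, v 2] := by ext i; fin_cases i <;> rfl
  rw [h0, h1, h2, h3]
  simp only [fderiv_alternating_apply h]
  simp
  ring

variable {A : F → F [⋀^Fin 2]→L[ℝ] ℝ} {B C : F → F [⋀^Fin 3]→L[ℝ] ℝ} {y : F} {s : ℝ}
  {f g h : ℝ → ℝ} {f' g' h' : ℝ}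

theorem fderiv_coneForm_apply {Ψ : F × ℝ → (F × ℝ) [⋀^Fin 3]→L[ℝ] ℝ}
    (hΨ : ∀ᶠ q in 𝓝 (y, s), ∀ w, Ψ q w =
      f q.2 * (A q.1 ![(w 0).1, (w 1).1] * (w 2).2 - A q.1 ![(w 0).1, (w 2).1] * (w 1).2 +
        A q.1 ![(w 1).1, (w 2).1] * (w 0).2) +
      g q.2 * B q.1 (fun i => (w i).1) + h q.2 * C q.1 (fun i => (w i).1))
    (hd : DifferentiableAt ℝ Ψ (y, s))
    (hA : DifferentiableAt ℝ A y) (hB : DifferentiableAt ℝ B y) (hC : DifferentiableAt ℝ C y)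
    (hf : HasDerivAt f f' s) (hg : HasDerivAt g g' s) (hh : HasDerivAt h h' s)
    (u : F × ℝ) (w₀ w₁ w₂ : F × ℝ) :
    fderiv ℝ Ψ (y, s) u ![w₀, w₁, w₂] =
      f s * (fderiv ℝ A y u.1 ![w₀.1, w₁.1] * w₂.2 - fderiv ℝ A y u.1 ![w₀.1, w₂.1] * w₁.2 +
        fderiv ℝ A y u.1 ![w₁.1, w₂.1] * w₀.2) +
      f' * u.2 * (A y ![w₀.1, w₁.1] * w₂.2 - A y ![w₀.1, w₂.1] * w₁.2 +
        A y ![w₁.1, w₂.1] * w₀.2) +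
      (g s * fderiv ℝ B y u.1 ![w₀.1, w₁.1, w₂.1] + g' * u.2 * B y ![w₀.1, w₁.1, w₂.1]) +
      (h s * fderiv ℝ C y u.1 ![w₀.1, w₁.1, w₂.1] + h' * u.2 * C y ![w₀.1, w₁.1, w₂.1]) := by
  have hw : (fun i => (![w₀, w₁, w₂] i).1) = ![w₀.1, w₁.1, w₂.1] := by
    ext1 i; fin_cases i <;> rfl
  have hfst : HasFDerivAt (Prod.fst : F × ℝ → F) (ContinuousLinearMap.fst ℝ F ℝ) (y, s) :=
    hasFDerivAt_fst
  have hsnd : HasFDerivAt (Prod.snd : F × ℝ → ℝ) (ContinuousLinearMap.snd ℝ F ℝ) (y, s) :=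
    hasFDerivAt_snd
  have dA (w) := (hasFDerivAt_alternating_apply hA.hasFDerivAt w).comp (y, s) hfst
  have dB := (hasFDerivAt_alternating_apply hB.hasFDerivAt ![w₀.1, w₁.1, w₂.1]).comp (y, s) hfst
  have dC := (hasFDerivAt_alternating_apply hC.hasFDerivAt ![w₀.1, w₁.1, w₂.1]).comp (y, s) hfst
  have df := hf.hasFDerivAt.comp (y, s) hsnd
  have dg := hg.hasFDerivAt.comp (y, s) hsnd
  have dh := hh.hasFDerivAt.comp (y, s) hsnd
  have h1 := hasFDerivAt_alternating_apply hd.hasFDerivAt ![w₀, w₁, w₂]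
  have h2 := ((df.mul ((((dA ![w₀.1, w₁.1]).mul_const w₂.2).sub
    ((dA ![w₀.1, w₂.1]).mul_const w₁.2)).add ((dA ![w₁.1, w₂.1]).mul_const w₀.2))).add
    (dg.mul dB)).add (dh.mul dC)
  have h3 := h2.congr_of_eventuallyEq (f₁ := fun z => Ψ z ![w₀, w₁, w₂]) (by
    filter_upwards [hΨ] with q hq
    rw [hq, hw]
    rfl)
  refine (congrArg (fun L : F × ℝ →L[ℝ] ℝ => L u) (h1.unique h3)).trans ?_
  simp
  ring

/-- With `ds` the differential of the second coordinate, this is `d(f A ∧ ds + g B + h C) = f dA ∧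
ds + g dB + h dC - g' B ∧ ds - h' C ∧ ds`. The terms in `f'` cancel because `ds ∧ ds = 0`, and the
minus signs come from moving `ds` past a 3-form. -/
theorem extDeriv_coneForm_apply {Ψ : F × ℝ → (F × ℝ) [⋀^Fin 3]→L[ℝ] ℝ}
    (hΨ : ∀ᶠ q in 𝓝 (y, s), ∀ w, Ψ q w =
      f q.2 * (A q.1 ![(w 0).1, (w 1).1] * (w 2).2 - A q.1 ![(w 0).1, (w 2).1] * (w 1).2 +
        A q.1 ![(w 1).1, (w 2).1] * (w 0).2) +
      g q.2 * B q.1 (fun i => (w i).1) + h q.2 * C q.1 (fun i => (w i).1))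
    (hd : DifferentiableAt ℝ Ψ (y, s))
    (hA : DifferentiableAt ℝ A y) (hB : DifferentiableAt ℝ B y) (hC : DifferentiableAt ℝ C y)
    (hf : HasDerivAt f f' s) (hg : HasDerivAt g g' s) (hh : HasDerivAt h h' s)
    (v : Fin 4 → F × ℝ) :
    extDeriv Ψ (y, s) v =
      f s * (extDeriv A y ![(v 0).1, (v 1).1, (v 2).1] * (v 3).2 -
        extDeriv A y ![(v 0).1, (v 1).1, (v 3).1] * (v 2).2 +
        extDeriv A y ![(v 0).1, (v 2).1, (v 3).1] * (v 1).2 -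
        extDeriv A y ![(v 1).1, (v 2).1, (v 3).1] * (v 0).2) +
      g s * extDeriv B y (fun i => (v i).1) + h s * extDeriv C y (fun i => (v i).1) -
      g' * (B y ![(v 0).1, (v 1).1, (v 2).1] * (v 3).2 -
        B y ![(v 0).1, (v 1).1, (v 3).1] * (v 2).2 +
        B y ![(v 0).1, (v 2).1, (v 3).1] * (v 1).2 -
        B y ![(v 1).1, (v 2).1, (v 3).1] * (v 0).2) -
      h' * (C y ![(v 0).1, (v 1).1, (v 2).1] * (v 3).2 -
        C y ![(v 0).1, (v 1).1, (v 3).1] * (v 2).2 +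
        C y ![(v 0).1, (v 2).1, (v 3).1] * (v 1).2 -
        C y ![(v 1).1, (v 2).1, (v 3).1] * (v 0).2) := by
  rw [extDeriv_three_apply hd, extDeriv_three_apply hB, extDeriv_three_apply hC]
  simp only [extDeriv_two_apply hA, fderiv_coneForm_apply hΨ hd hA hB hC hf hg hh]
  ring

end ConeDerivative

/-! ### The nearly Kähler equations in a chart -/

section NearlyKahler

open scoped Topology

local notation "F₆" => EuclideanSpace ℝ (Fin 6)

variable {M : Type*} [TopologicalSpace M] [ChartedSpace (EuclideanSpace ℝ (Fin 6)) M]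
  [IsManifold (𝓡 6) ((⊤ : ℕ∞) : WithTop ℕ∞) M]
  {o : TangentOrientation M} {ω : DiffForm (𝓡 6) M 2} {φ : DiffForm (𝓡 6) M 3}

theorem IsNearlyKahler.extDeriv_omega (h : IsNearlyKahler o ω φ) (x : M) {y : F₆}
    (hy : y ∈ (extChartAt (𝓡 6) x).target) :
    extDeriv (chartForm (𝓡 6) ω x) y = (3 : ℝ) • chartForm (𝓡 6) φ x y := by
  rw [← chartForm_extD h.isSU3Structure.smooth_omega x hy,
    show extD (𝓡 6) ω = fun x => (3 : ℝ) • φ x from funext h.d_omega]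
  rfl

/-- `3 dφ = d(dω) = 0`. The equation `dω = 3φ` can be differentiated because it holds in one chart
on a neighbourhood of `y`. -/
theorem IsNearlyKahler.extDeriv_phi (h : IsNearlyKahler o ω φ) (x : M) {y : F₆}
    (hy : y ∈ (extChartAt (𝓡 6) x).target) : extDeriv (chartForm (𝓡 6) φ x) y = 0 := by
  have h1 : extDeriv (chartForm (𝓡 6) ω x) =ᶠ[𝓝 y] (3 : ℝ) • chartForm (𝓡 6) φ x := by
    filter_upwards [(isOpen_extChartAt_target x).mem_nhds hy] with y' hy'
    exact h.extDeriv_omega x hy'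
  have h2 := h1.extDeriv_eq
  rw [extDeriv_extDeriv_apply (h.isSU3Structure.smooth_omega.contDiffAt hy)
    (by simpa using WithTop.coe_le_coe.2 (le_top : (2 : ℕ∞) ≤ ⊤)), extDeriv_smul] at h2
  exact (smul_eq_zero.1 h2.symm).resolve_left (by norm_num)

/-- The factor is 4 because the bracket is `½ ω ∧ ω` and `dφ̂ = -2 ω ∧ ω`. -/
theorem IsNearlyKahler.extDeriv_hat (h : IsNearlyKahler o ω φ) (x : M) {y : F₆}
    (hy : y ∈ (extChartAt (𝓡 6) x).target) (v : Fin 4 → F₆) :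
    extDeriv (chartForm (𝓡 6) (hat o φ) x) y v =
      -(4 * (chartForm (𝓡 6) ω x y ![v 0, v 1] * chartForm (𝓡 6) ω x y ![v 2, v 3] -
        chartForm (𝓡 6) ω x y ![v 0, v 2] * chartForm (𝓡 6) ω x y ![v 1, v 3] +
        chartForm (𝓡 6) ω x y ![v 0, v 3] * chartForm (𝓡 6) ω x y ![v 1, v 2])) := by
  obtain ⟨e, he, -, -⟩ := h.isSU3Structure.exists_frame_chartForm x hy
  have h1 : (chartForm (𝓡 6) (extD (𝓡 6) (hat o φ)) x y) v =
      -(2 * (altWedge (chartForm (𝓡 6) ω x y).toAlternatingMap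
        (chartForm (𝓡 6) ω x y).toAlternatingMap : F₆ [⋀^Fin (2 + 2)]→ₗ[ℝ] ℝ) v) := by
    have h2 : extD (𝓡 6) (hat o φ) = fun x => -((2 : ℝ) • wedge (ω x) (ω x)) :=
      funext fun x => eq_neg_of_add_eq_zero_left (h.d_hat x)
    rw [h2, altWedge_apply]
    refine congrArg (fun r : ℝ => -(2 * r)) ?_
    exact altWedge_apply _ _ _
  have he' (u : Fin 2 → F₆) : omegaModel e u = chartForm (𝓡 6) ω x y u := by
    rw [← he]
    rfl
  rw [← chartForm_extD h.isSU3Structure.smooth_hat x hy, h1, he, altWedge_omegaModel_self]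
  simp only [he']
  ring

end NearlyKahler

/-! ### The sine cone -/

section SineCone

open scoped Topology

local notation "F₆" => EuclideanSpace ℝ (Fin 6)

variable {M : Type*} [TopologicalSpace M] [ChartedSpace (EuclideanSpace ℝ (Fin 6)) M]
  {o : TangentOrientation M} {ω : DiffForm (𝓡 6) M 2} {φ : DiffForm (𝓡 6) M 3}

theorem chartForm_sineOmega (t : ℝ) (x : M) (y : F₆) (v : Fin 2 → F₆) :
    chartForm (𝓡 6) (sineOmega ω t) x y v = Real.sin t ^ 2 * chartForm (𝓡 6) ω x y v := rfl

theorem chartForm_sinePhi (t : ℝ) (x : M) (y : F₆) (v : Fin 3 → F₆) :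
    chartForm (𝓡 6) (sinePhi o φ t) x y v = Real.sin t ^ 4 * chartForm (𝓡 6) (hat o φ) x y v +
      Real.sin t ^ 3 * Real.cos t * chartForm (𝓡 6) φ x y v := by
  change Real.sin t ^ 3 * (Real.sin t * chartForm (𝓡 6) (hat o φ) x y v +
      Real.cos t * chartForm (𝓡 6) φ x y v) = _
  ring

theorem IsSU3Structure.exists_model_frame (h : IsSU3Structure o ω φ) (x : M) :
    ∃ e : Module.Basis (Fin 6) ℝ F₆,
      (show F₆ [⋀^Fin 2]→L[ℝ] ℝ from ω x).toAlternatingMap = omegaModel e ∧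
      (show F₆ [⋀^Fin 3]→L[ℝ] ℝ from φ x).toAlternatingMap = phiModel e ∧
      (show F₆ [⋀^Fin 3]→L[ℝ] ℝ from hat o φ x).toAlternatingMap = phiHatModel e ∧
      ∀ X Y : F₆, su3Metric o ω φ x X Y = basisInner e X Y := by
  obtain ⟨e, ho, hω, hφ⟩ := h.exists_frame x
  refine ⟨e, hω, hφ, hat_eq_phiHatModel ho hφ, fun X Y => ?_⟩
  exact congrArg (fun B : LinearMap.BilinForm ℝ F₆ => B X Y) (su3Metric_eq_basisInner ho hω hφ)

/-- A frame of `M × (0, π)` adapted to the form `ω_t ∧ dt + φ_t`, obtained from a frame of `M`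
adapted to `(ω, φ)`. -/
def sineConeBasis (e : Module.Basis (Fin 6) ℝ F₆) (t : coneInterval) :
    Module.Basis (Fin 7) ℝ (F₆ × ℝ) :=
  prodBasis (rotateBasis e (Real.sin t) (Real.cos t) (Real.sin t)
    (Real.sin_pos_of_mem_Ioo t.2).ne' (Real.cos_sq_add_sin_sq t))

variable {p : M × coneInterval} {e : Module.Basis (Fin 6) ℝ F₆}

/-- The rotated and scaled frame turns `(ω, φ)` into `(ω_t, φ_t)`, and `dt` supplies the seventh
covector. -/
theorem liftForm_eq_psiModel_sineConeBasis
    (hω : (show F₆ [⋀^Fin 2]→L[ℝ] ℝ from ω p.1).toAlternatingMap = omegaModel e)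
    (hφ : (show F₆ [⋀^Fin 3]→L[ℝ] ℝ from φ p.1).toAlternatingMap = phiModel e)
    (hh : (show F₆ [⋀^Fin 3]→L[ℝ] ℝ from hat o φ p.1).toAlternatingMap = phiHatModel e) :
    (show (F₆ × ℝ) [⋀^Fin 3]→L[ℝ] ℝ from
      liftForm (sineOmega ω) (sinePhi o φ) p).toAlternatingMap =
      psiModel (sineConeBasis e p.2) := by
  refine AlternatingMap.ext fun w => (liftForm_apply _ _ p w).trans ?_
  rw [sineConeBasis, psiModel_prodBasis, omegaModel_rotateBasis, phiModel_rotateBasis,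
    ← hω, ← hφ, ← hh]
  rfl

theorem sineConeMetric_apply (hg : ∀ X Y : F₆, su3Metric o ω φ p.1 X Y = basisInner e X Y)
    (X Y : F₆ × ℝ) :
    (show LinearMap.BilinForm ℝ (F₆ × ℝ) from sineConeMetric o ω φ p) X Y =
      basisInner (sineConeBasis e p.2) X Y := by
  have h1 := mfderiv_fst_cone_apply p
  have h2 := mfderiv_coe_snd_apply p
  rw [sineConeBasis, basisInner_prodBasis, basisInner_rotateBasis, LinearMap.smul_apply,
    LinearMap.smul_apply, smul_eq_mul, ← hg, ← h2 X, ← h2 Y, ← h1 X, ← h1 Y]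
  rfl

/-- The cone metric makes one explicit adapted frame orthonormal, and all adapted frames induce the
same metric. -/
theorem IsSU3Structure.isG2Metric_sineCone (h : IsSU3Structure o ω φ) :
    IsG2Metric coneModel (liftForm (sineOmega ω) (sinePhi o φ)) (sineConeMetric o ω φ) := by
  intro p b hb i j
  obtain ⟨e, hω, hφ, hh, hg⟩ := h.exists_model_frame p.1
  have hψ := liftForm_eq_psiModel_sineConeBasis hω hφ hh
  let b' : Module.Basis (Fin 7) ℝ (F₆ × ℝ) := b
  have hb' : psiModel (sineConeBasis e p.2) = psiModel b' := hψ.symm.trans hb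
  refine (sineConeMetric_apply hg (b' i) (b' j)).trans ?_
  rw [← (basisInner_eq_and_det_eq_of_psiModel_eq _ b' hb').1, basisInner_self]

variable [IsManifold (𝓡 6) ((⊤ : ℕ∞) : WithTop ℕ∞) M]

theorem IsSU3Structure.sine (h : IsSU3Structure o ω φ) {t : ℝ} (ht : t ∈ Set.Ioo 0 Real.pi) :
    IsSU3Structure o (sineOmega ω t) (sinePhi o φ t) where
  smooth_omega x₀ := (h.smooth_omega x₀).const_smul (Real.sin t ^ 2)
  smooth_phi x₀ := (((h.smooth_hat x₀).const_smul (Real.sin t)).add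
    ((h.smooth_phi x₀).const_smul (Real.cos t))).const_smul (Real.sin t ^ 3)
  exists_frame x := by
    obtain ⟨e, ho, hω, hφ⟩ := h.exists_frame x
    -- Scaling by `sin t > 0` and rotation of `z¹` by `e^{-it} = cos t - i sin t`.
    refine ⟨rotateBasis e (Real.sin t) (Real.cos t) (Real.sin t)
      (Real.sin_pos_of_mem_Ioo ht).ne' (Real.cos_sq_add_sin_sq t), ?_, ?_, ?_⟩
    · rw [orientation_rotateBasis, ho]
    · rw [omegaModel_rotateBasis, ← hω]
      rfl
    · rw [phiModel_rotateBasis, ← hφ, ← hat_eq_phiHatModel ho hφ]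
      rfl

theorem chartForm_sineCone {p : M × coneInterval} {q : F₆ × ℝ}
    (hq : q ∈ (extChartAt coneModel p).target) (w : Fin 3 → F₆ × ℝ) :
    chartForm coneModel (liftForm (sineOmega ω) (sinePhi o φ)) p q w =
      Real.sin q.2 ^ 2 * (chartForm (𝓡 6) ω p.1 q.1 ![(w 0).1, (w 1).1] * (w 2).2 -
        chartForm (𝓡 6) ω p.1 q.1 ![(w 0).1, (w 2).1] * (w 1).2 +
        chartForm (𝓡 6) ω p.1 q.1 ![(w 1).1, (w 2).1] * (w 0).2) +
      Real.sin q.2 ^ 4 * chartForm (𝓡 6) (hat o φ) p.1 q.1 (fun i => (w i).1) +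
      Real.sin q.2 ^ 3 * Real.cos q.2 * chartForm (𝓡 6) φ p.1 q.1 (fun i => (w i).1) := by
  rw [chartForm_liftForm _ _ hq]
  simp only [chartForm_sineOmega, chartForm_sinePhi]
  ring

theorem IsSU3Structure.smooth_sineCone (h : IsSU3Structure o ω φ) :
    IsSmoothForm coneModel (liftForm (sineOmega ω) (sinePhi o φ)) := by
  intro p
  refine contDiffOn_alternating_of_apply (Module.finBasis ℝ (F₆ × ℝ)) fun i => ?_
  refine ContDiffOn.congr ?_ fun q hq => chartForm_sineCone hq _
  have hfst : ContDiffOn ℝ ((⊤ : ℕ∞) : WithTop ℕ∞) (Prod.fst : F₆ × ℝ → F₆)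
      (extChartAt coneModel p).target := contDiff_fst.contDiffOn
  have hmaps : Set.MapsTo (Prod.fst : F₆ × ℝ → F₆) (extChartAt coneModel p).target
      (extChartAt (𝓡 6) p.1).target := fun q hq => (mem_extChartAt_cone_target.1 hq).1
  have hω (v) := (contDiffOn_alternating_apply (h.smooth_omega p.1) v).comp hfst hmaps
  have hφ (v) := (contDiffOn_alternating_apply (h.smooth_phi p.1) v).comp hfst hmaps
  have hh (v) := (contDiffOn_alternating_apply (h.smooth_hat p.1) v).comp hfst hmaps
  have hs : ContDiffOn ℝ ((⊤ : ℕ∞) : WithTop ℕ∞) (fun q : F₆ × ℝ => Real.sin q.2)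
      (extChartAt coneModel p).target := (Real.contDiff_sin.comp contDiff_snd).contDiffOn
  have hc : ContDiffOn ℝ ((⊤ : ℕ∞) : WithTop ℕ∞) (fun q : F₆ × ℝ => Real.cos q.2)
      (extChartAt coneModel p).target := (Real.contDiff_cos.comp contDiff_snd).contDiffOn
  exact (((hs.pow 2).mul ((((hω _).mul contDiffOn_const).sub ((hω _).mul contDiffOn_const)).add
    ((hω _).mul contDiffOn_const))).add ((hs.pow 4).mul (hh _))).add
      (((hs.pow 3).mul hc).mul (hφ _))

theorem IsNearlyKahler.extD_sineCone (h : IsNearlyKahler o ω φ)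
    (hω : (show F₆ [⋀^Fin 2]→L[ℝ] ℝ from ω p.1).toAlternatingMap = omegaModel e)
    (hφ : (show F₆ [⋀^Fin 3]→L[ℝ] ℝ from φ p.1).toAlternatingMap = phiModel e)
    (hh : (show F₆ [⋀^Fin 3]→L[ℝ] ℝ from hat o φ p.1).toAlternatingMap = phiHatModel e)
    (v : Fin 4 → F₆ × ℝ) :
    (show (F₆ × ℝ) [⋀^Fin 4]→L[ℝ] ℝ from
      extD coneModel (liftForm (sineOmega ω) (sinePhi o φ)) p) v =
      4 * hodgeStar (k := 3) (m := 4) (sineConeBasis e p.2) (psiModel (sineConeBasis e p.2)) v := by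
  have : IsManifold (𝓡 6) 1 M := .of_le (n := ((⊤ : ℕ∞) : WithTop ℕ∞)) (by simp)
  have : IsManifold coneModel 1 (M × coneInterval) :=
    .of_le (n := ((⊤ : ℕ∞) : WithTop ℕ∞)) (by simp)
  obtain ⟨y, hy⟩ : ∃ y : F₆, y = extChartAt (𝓡 6) p.1 p.1 := ⟨_, rfl⟩
  have hyt : y ∈ (extChartAt (𝓡 6) p.1).target := hy ▸ mem_extChartAt_target p.1
  have hpt := mem_extChartAt_target (I := coneModel) p
  rw [extD_apply]
  have hS := h.isSU3Structure
  have hd := (hS.smooth_sineCone.contDiffAt hpt).differentiableAt (by simp)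
  rw [extChartAt_cone_apply_self, ← hy] at hd hpt ⊢
  have hd1 : HasDerivAt (fun t => Real.sin t ^ 2) (2 * Real.sin p.2 * Real.cos p.2) (p.2 : ℝ) := by
    refine ((Real.hasDerivAt_sin (p.2 : ℝ)).pow 2).congr_deriv ?_
    norm_num
  have hd2 : HasDerivAt (fun t => Real.sin t ^ 4) (4 * Real.sin p.2 ^ 3 * Real.cos p.2)
      (p.2 : ℝ) := by
    refine ((Real.hasDerivAt_sin (p.2 : ℝ)).pow 4).congr_deriv ?_
    norm_num
  have hd3 : HasDerivAt (fun t => Real.sin t ^ 3 * Real.cos t)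
      (3 * Real.sin p.2 ^ 2 * Real.cos p.2 ^ 2 - Real.sin p.2 ^ 4) (p.2 : ℝ) := by
    refine (((Real.hasDerivAt_sin (p.2 : ℝ)).pow 3).mul
      (Real.hasDerivAt_cos (p.2 : ℝ))).congr_deriv ?_
    simp only [Pi.pow_apply]
    norm_num
    ring
  have hΨ := Filter.mem_of_superset ((isOpen_extChartAt_target p).mem_nhds hpt)
    fun q hq w => chartForm_sineCone (o := o) (ω := ω) (φ := φ) hq w
  rw [extDeriv_coneForm_apply (f := fun t => Real.sin t ^ 2) (g := fun t => Real.sin t ^ 4)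
    (h := fun t => Real.sin t ^ 3 * Real.cos t) hΨ hd
    ((hS.smooth_omega.contDiffAt hyt).differentiableAt (by simp))
    ((hS.smooth_hat.contDiffAt hyt).differentiableAt (by simp))
    ((hS.smooth_phi.contDiffAt hyt).differentiableAt (by simp)) hd1 hd2 hd3 v]
  rw [h.extDeriv_omega p.1 hyt, h.extDeriv_hat p.1 hyt, h.extDeriv_phi p.1 hyt]
  rw [sineConeBasis, hodgeStar_psiModel_prodBasis, omegaModel_rotateBasis, phiHatModel_rotateBasis]
  have hA (u : Fin 2 → F₆) : chartForm (𝓡 6) ω p.1 y u = omegaModel e u := by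
    rw [hy]
    exact (chartForm_self ω p.1 u).trans (DFunLike.congr_fun hω u)
  have hC (u : Fin 3 → F₆) : chartForm (𝓡 6) φ p.1 y u = phiModel e u := by
    rw [hy]
    exact (chartForm_self φ p.1 u).trans (DFunLike.congr_fun hφ u)
  have hB (u : Fin 3 → F₆) : chartForm (𝓡 6) (hat o φ) p.1 y u = phiHatModel e u := by
    rw [hy]
    exact (chartForm_self (hat o φ) p.1 u).trans (DFunLike.congr_fun hh u)
  simp only [ContinuousAlternatingMap.smul_apply, AlternatingMap.smul_apply,
    AlternatingMap.sub_apply, smul_eq_mul, hA, hB, hC, ContinuousAlternatingMap.coe_zero, Pi.zero_apply]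
  have hcs := Real.cos_sq_add_sin_sq (p.2 : ℝ)
  -- The terms in `ω ∧ ω` and `φ̂ ∧ dt` agree identically. The coefficient of `φ ∧ dt` requires `3
  -- sin² - (3 sin² cos² - sin⁴) = 4 sin⁴`.
  linear_combination (-3) * Real.sin p.2 ^ 2 *
    (phiModel e ![(v 0).1, (v 1).1, (v 2).1] * (v 3).2 -
        phiModel e ![(v 0).1, (v 1).1, (v 3).1] * (v 2).2 +
        phiModel e ![(v 0).1, (v 2).1, (v 3).1] * (v 1).2 -
        phiModel e ![(v 1).1, (v 2).1, (v 3).1] * (v 0).2) * hcs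

theorem IsSU3Structure.isG2Structure_sineCone (h : IsSU3Structure o ω φ) :
    IsG2Structure coneModel (liftForm (sineOmega ω) (sinePhi o φ)) where
  smooth := h.smooth_sineCone
  exists_frame p := by
    obtain ⟨e, hω, hφ, hh, -⟩ := h.exists_model_frame p.1
    exact ⟨sineConeBasis e p.2, liftForm_eq_psiModel_sineConeBasis hω hφ hh⟩

theorem IsNearlyKahler.isNearlyParallel_sineCone (h : IsNearlyKahler o ω φ) :
    IsNearlyParallel coneModel (liftForm (sineOmega ω) (sinePhi o φ)) := by
  refine ⟨h.isSU3Structure.isG2Structure_sineCone, 4, by norm_num, fun p b hb v => ?_⟩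
  obtain ⟨e, hω, hφ, hh, -⟩ := h.isSU3Structure.exists_model_frame p.1
  have hψ := liftForm_eq_psiModel_sineConeBasis hω hφ hh
  let b' : Module.Basis (Fin 7) ℝ (F₆ × ℝ) := b
  have hb' : psiModel (sineConeBasis e p.2) = psiModel b' := hψ.symm.trans hb
  -- The Hodge star is required for an arbitrary adapted frame `b`, whereas the derivative was
  -- computed with the explicit one; both give the same metric and volume.
  obtain ⟨h1, h2⟩ := basisInner_eq_and_det_eq_of_psiModel_eq _ b' hb'
  refine (h.extD_sineCone hω hφ hh v).trans (congrArg (fun r : ℝ => 4 * r) ?_)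
  rw [← hψ]
  exact (hodgeStar_eq_of_basisInner_eq (k := 3) (m := 4) _ b' h1 h2 _ v).symm

end SineCone

end SineCone

end

open SineCone in
theorem mainTheorem3 {M : Type*} [TopologicalSpace M]
    [ChartedSpace (EuclideanSpace ℝ (Fin 6)) M]
    [IsManifold (𝓡 6) ((⊤ : ℕ∞) : WithTop ℕ∞) M]
    (o : TangentOrientation M) (ω : DiffForm (𝓡 6) M 2) (φ : DiffForm (𝓡 6) M 3)
    (h : IsNearlyKahler o ω φ) :
    (∀ t ∈ Set.Ioo 0 Real.pi, IsSU3Structure o (sineOmega ω t) (sinePhi o φ t)) ∧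
      IsNearlyParallel coneModel (liftForm (sineOmega ω) (sinePhi o φ)) ∧
      IsG2Metric coneModel (liftForm (sineOmega ω) (sinePhi o φ)) (sineConeMetric o ω φ) :=
  ⟨fun _ ht => h.isSU3Structure.sine ht, h.isNearlyParallel_sineCone,
    h.isSU3Structure.isG2Metric_sineCone⟩
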